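/- Let $0<R\le\infty$ and let $f(z)=\sum_{n=0}^\infty a_nz^n$ be a non-constant analytic function on $\{z\in\mathbb C:|z|<R\}$. For $0\le r<R$ put $$\mu_f(r)=\max_{n\ge 0}|a_n|r^n,\qquad S_f(r)=\Big(\sum_{n=0}^\infty|a_n|^2r^{2n}\Big)^{1/2}.$$ Let $\rho\in[0,R)$ and let $h:[\rho,R)\to[0,\infty)$ be a continuous, (not necessarily strictly) increasing function with $\int_\rho^R\frac{h(r)}{r}\,dr=\infty$, and suppose that $\lim_{r\to R}h(r)>1$ and $\lim_{r\to R}h(r)\mu_f(r)>e$, where the limits may be infinite. Let $(X_n)_{n\ge 0}$ be a sequence of independent complex random variables on a probability space $(\Omega,\mathcal A,\mathbb P)$ with $\mathbb E X_n=0$ for all $n$, which is subgaussian: there are constants $K,\tau>0$ such that $\mathbb P(|X_n|>t)\le Ke^{-t^2/\tau^2}$ for all $n\ge 0$ and $t\ge 0$. Then, almost surely, $\sum_{n=0}^\infty a_nX_nz^n$ converges for all $|z|<R$ and defines an analytic function there. Moreover, there exist an open set $E\subset[0,R)$ with $\int_{E\cap[\rho,R)}\frac{h(r)}{r}\,dr<\infty$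 (that is, of finite $h$-logarithmic measure) and a constant $C>0$, both independent of $\omega\in\Omega$, such that, almost surely, there exists some $r_0\in(\rho,R)$ with $$\max_{|z|=r}\Big|\sum_{n=0}^\infty a_nX_nz^n\Big|\le C\sqrt{\log\big(h(r)\log(h(r)\mu_f(r))\big)}\;S_f(r)$$ for all $r\in[r_0,R)$ with $r\notin E$. -/

import Mathlib

open MeasureTheory ProbabilityTheory Filter Topology Set
open scoped ENNReal

/-- The open disc `|z| < R` in the complex plane, where `0 < R ≤ ∞`. -/
def openDisc (R : ℝ≥0∞) : Set ℂ := {z | ENNReal.ofReal ‖z‖ < R}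

/-- The interval `[ρ, R)` of real numbers, where `0 ≤ ρ` and `R ≤ ∞`. -/
def radii (ρ : ℝ) (R : ℝ≥0∞) : Set ℝ := {r | ρ ≤ r ∧ ENNReal.ofReal r < R}

/-- The filter "`r → R`, `r < R`" on the real line, for `0 < R ≤ ∞`: it is `𝓝[<] R` for finite `R`
and `atTop` for `R = ∞`. -/
def tendingTo (R : ℝ≥0∞) : Filter ℝ := comap ENNReal.ofReal (𝓝[<] R)

/-- `lim_{r → R} g(r) > c`, where the limit exists in `[0, ∞]` and `g` is nonnegative near `R`. -/
def LimitGT (R : ℝ≥0∞) (g : ℝ → ℝ) (c : ℝ) : Prop :=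
  ∃ L : ℝ≥0∞, Tendsto (fun r => ENNReal.ofReal (g r)) (tendingTo R) (𝓝 L) ∧ ENNReal.ofReal c < L

/-- The maximum term `μ_f(r) = max_n |a_n| r^n` of the power series with coefficients `a`.
The supremum is a maximum for every nonnegative `r` below the radius of convergence. -/
noncomputable def maxTerm (a : ℕ → ℂ) (r : ℝ) : ℝ := ⨆ n, ‖a n‖ * r ^ n

/-- `S_f(r) = (∑ |a_n|² r^{2n})^{1/2}`. -/
noncomputable def ellTwoMean (a : ℕ → ℂ) (r : ℝ) : ℝ :=
  Real.sqrt (∑' n, ‖a n‖ ^ 2 * r ^ (2 * n))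

/-- The integral `∫_{E ∩ [ρ, R)} h(r) / r dr`, with values in `[0, ∞]`. -/
noncomputable def logMeasure (h : ℝ → ℝ) (ρ : ℝ) (R : ℝ≥0∞) (E : Set ℝ) : ℝ≥0∞ :=
  ∫⁻ r in E ∩ radii ρ R, ENNReal.ofReal (h r / r)

/-- `h : [ρ, R) → [0, ∞)` is continuous and increasing (in the wide sense), and
`∫_ρ^R h(r) / r dr = ∞`. Values of `h` outside `[ρ, R)` are irrelevant. -/
structure IsLogWeight (h : ℝ → ℝ) (ρ : ℝ) (R : ℝ≥0∞) : Prop where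
  nonneg : ∀ r ∈ radii ρ R, 0 ≤ h r
  continuousOn : ContinuousOn h (radii ρ R)
  monotoneOn : MonotoneOn h (radii ρ R)
  integral_eq_top : logMeasure h ρ R univ = ∞

/-- A sequence of complex random variables is subgaussian: there are `K, τ > 0` such that
`P(|X_n| > t) ≤ K exp(-t² / τ²)` for all `n` and all `t ≥ 0`. -/
def IsSubgaussianSeq {Ω : Type*} [MeasurableSpace Ω] (P : Measure Ω) (X : ℕ → Ω → ℂ) : Prop :=
  ∃ K τ : ℝ, 0 < K ∧ 0 < τ ∧ ∀ n : ℕ, ∀ t : ℝ, 0 ≤ t →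
    P {ω | t < ‖X n ω‖} ≤ ENNReal.ofReal (K * Real.exp (-(t ^ 2 / τ ^ 2)))

/-- The random power series `∑ a_n X_n(ω) z^n`. -/
noncomputable def randomSeries {Ω : Type*} (a : ℕ → ℂ) (X : ℕ → Ω → ℂ) (ω : Ω) (z : ℂ) : ℂ :=
  ∑' n, a n * X n ω * z ^ n

/-! Write V = log(h μ_f), φ = h V and F = ∑ a_n X_n z^n. For a fixed z, F(z) is subgaussian with
variance proxy of order S_f(|z|)², so E|F(z)|^{2k} ≤ 4 (b k S_f²)^k. A union bound over the circle
is replaced by an integral: the moments, normalised by (2b k S_f²)^k, are integrated over the disc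
against a finite polar measure and summed over k. By Tonelli, almost surely all these integrals lie
below one random J.

To return from integrals to points, Cauchy's formula is applied to the analytic function F^{2k} and
averaged over a thin annulus just outside |z| = r. This costs a power of φ(r) times J. With k = ⌈log
φ⌉ the cost is at most e^{11k}, which a k-th root turns into a constant; what remains is |F|² ≤
const · k · S_f², the claimed bound. The factor J is absorbed because φ → ∞, so it affects `r₀` but
not the constant.

The annulus must be so thin that S_f grows there by a bounded factor. That is a deterministic,
Wiman–Valiron type fact: off a set of finite h-logarithmic measure a Borel growth lemma applied to V
gives |a_n| r^n (1+δ)^n ≤ e μ_f(r) with δ = 1/(e h V²), and then S_f is stable on [r, r(1+δ²/4)].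
The main lemmas are `exists_isOpen_forall_notMem_geometric_decay`,
`ellTwoMean_le_of_geometric_decay`, `ae_exists_polar_moments_le` and `norm_le_of_polar_moments`. -/

/-! ### Power series with bounded terms. -/

/-- The terms `|a_n| r^n` stay bounded for every nonnegative `r < R`. -/
def BoundedTerms (a : ℕ → ℂ) (R : ℝ≥0∞) : Prop :=
  ∀ r : ℝ, 0 ≤ r → ENNReal.ofReal r < R → BddAbove (range fun n => ‖a n‖ * r ^ n)

lemma boundedTerms_of_hasSum {a : ℕ → ℂ} {R : ℝ≥0∞} {f : ℂ → ℂ}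
    (hf : ∀ z ∈ openDisc R, HasSum (fun n => a n * z ^ n) (f z)) : BoundedTerms a R := by
  intro r hr hrR
  have hz : (r : ℂ) ∈ openDisc R := by
    simp only [openDisc, mem_ofPred_eq, Complex.norm_real, Real.norm_eq_abs, abs_of_nonneg hr, hrR]
  have h1 := ((hf _ hz).summable.tendsto_atTop_zero).norm.bddAbove_range
  have h2 : (fun n => ‖a n‖ * r ^ n) = fun n => ‖a n * (r : ℂ) ^ n‖ := by
    funext n
    rw [norm_mul, norm_pow, Complex.norm_real, Real.norm_eq_abs, abs_of_nonneg hr]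
  rw [h2]
  exact h1

lemma exists_coeff_ne_zero {a : ℕ → ℂ} {R : ℝ≥0∞} {f : ℂ → ℂ}
    (hf : ∀ z ∈ openDisc R, HasSum (fun n => a n * z ^ n) (f z))
    (hne : ¬ ∃ c : ℂ, ∀ z ∈ openDisc R, f z = c) : ∃ n, 1 ≤ n ∧ a n ≠ 0 := by
  by_contra! hcon
  refine hne ⟨a 0, fun z hz => ?_⟩
  refine (hf z hz).unique ?_
  have := hasSum_single (f := fun n => a n * z ^ n) 0 (fun n hn => by
    rw [hcon n (Nat.one_le_iff_ne_zero.2 hn), zero_mul])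
  simpa using this

lemma exists_radius_between {r : ℝ} {R : ℝ≥0∞} (hrR : ENNReal.ofReal r < R) :
    ∃ s : ℝ, r < s ∧ 0 < s ∧ ENNReal.ofReal s < R := by
  obtain ⟨t, ht, htR⟩ := exists_between hrR
  have htop : t ≠ ∞ := (htR.trans_le le_top).ne
  have ht0 : 0 < t := pos_of_gt ht
  refine ⟨t.toReal, ?_, ENNReal.toReal_pos ht0.ne' htop, by rwa [ENNReal.ofReal_toReal htop]⟩
  by_contra! hcon
  exact absurd (ENNReal.le_ofReal_iff_toReal_le htop (ENNReal.toReal_nonneg.trans hcon) |>.2 hcon)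
    (not_le.2 ht)

lemma ofReal_lt_of_le {r s : ℝ} {R : ℝ≥0∞} (hrs : r ≤ s) (hs : ENNReal.ofReal s < R) :
    ENNReal.ofReal r < R := (ENNReal.ofReal_le_ofReal hrs).trans_lt hs

namespace BoundedTerms

variable {a : ℕ → ℂ} {R : ℝ≥0∞}

/-- The weight (n+1)² is there for the random factors, which almost surely are O((n+1)²). -/
lemma summable_sq_mul (ha : BoundedTerms a R) {r : ℝ} (hr : 0 ≤ r) (hrR : ENNReal.ofReal r < R) :
    Summable fun n : ℕ => ((n : ℝ) + 1) ^ 2 * (‖a n‖ * r ^ n) := by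
  obtain ⟨s, hrs, hs, hsR⟩ := exists_radius_between hrR
  obtain ⟨B, hB⟩ := ha s hs.le hsR
  have hq0 : 0 ≤ r / s := div_nonneg hr hs.le
  have hq1 : ‖r / s‖ < 1 := by rw [Real.norm_of_nonneg hq0]; exact (div_lt_one hs).2 hrs
  have h0 := summable_geometric_of_norm_lt_one hq1
  have h1 := summable_pow_mul_geometric_of_norm_lt_one 1 hq1
  have h2 := summable_pow_mul_geometric_of_norm_lt_one 2 hq1
  have h3 := (((h2.add (h1.mul_left 2)).add h0).mul_left B)
  refine Summable.of_nonneg_of_le (fun n => by positivity) (fun n => ?_) h3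
  have hBn : ‖a n‖ * s ^ n ≤ B := hB ⟨n, rfl⟩
  have e1 : ‖a n‖ * r ^ n = (‖a n‖ * s ^ n) * (r / s) ^ n := by
    rw [div_pow]; field_simp
  rw [e1]
  calc ((n : ℝ) + 1) ^ 2 * ((‖a n‖ * s ^ n) * (r / s) ^ n)
      ≤ ((n : ℝ) + 1) ^ 2 * (B * (r / s) ^ n) := by gcongr
    _ = _ := by ring

lemma summable_sq (ha : BoundedTerms a R) {r : ℝ} (hr : 0 ≤ r) (hrR : ENNReal.ofReal r < R) :
    Summable fun n : ℕ => ‖a n‖ ^ 2 * r ^ (2 * n) := by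
  obtain ⟨B, hB⟩ := ha r hr hrR
  refine Summable.of_nonneg_of_le (fun n => by positivity) (fun n => ?_)
    ((ha.summable_sq_mul hr hrR).mul_left B)
  have hBn : ‖a n‖ * r ^ n ≤ B := hB ⟨n, rfl⟩
  have h0 : 0 ≤ ‖a n‖ * r ^ n := by positivity
  have hn : (1 : ℝ) ≤ ((n : ℝ) + 1) ^ 2 := one_le_pow₀ (by linarith [n.cast_nonneg (α := ℝ)])
  calc ‖a n‖ ^ 2 * r ^ (2 * n) = (‖a n‖ * r ^ n) * (‖a n‖ * r ^ n) := by ring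
    _ ≤ B * (1 * (‖a n‖ * r ^ n)) := by rw [one_mul]; gcongr
    _ ≤ _ := by
      have : 0 ≤ B := h0.trans hBn
      gcongr

lemma term_le_maxTerm (ha : BoundedTerms a R) {r : ℝ} (hr : 0 ≤ r) (hrR : ENNReal.ofReal r < R)
    (n : ℕ) : ‖a n‖ * r ^ n ≤ maxTerm a r := le_ciSup (ha r hr hrR) n

lemma maxTerm_mono (ha : BoundedTerms a R) {r s : ℝ} (hr : 0 ≤ r) (hrs : r ≤ s)
    (hsR : ENNReal.ofReal s < R) : maxTerm a r ≤ maxTerm a s :=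
  ciSup_mono (ha s (hr.trans hrs) hsR) fun n => by gcongr

lemma sq_ellTwoMean {r : ℝ} (hr : 0 ≤ r) :
    ellTwoMean a r ^ 2 = ∑' n, ‖a n‖ ^ 2 * r ^ (2 * n) :=
  Real.sq_sqrt (tsum_nonneg fun n => by positivity)

lemma term_le_ellTwoMean (ha : BoundedTerms a R) {r : ℝ} (hr : 0 ≤ r) (hrR : ENNReal.ofReal r < R)
    (n : ℕ) : ‖a n‖ * r ^ n ≤ ellTwoMean a r := by
  refine Real.le_sqrt_of_sq_le ?_
  calc (‖a n‖ * r ^ n) ^ 2 = ‖a n‖ ^ 2 * r ^ (2 * n) := by ring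
    _ ≤ _ := (ha.summable_sq hr hrR).le_tsum n fun j _ => by positivity

lemma maxTerm_le_ellTwoMean (ha : BoundedTerms a R) {r : ℝ} (hr : 0 ≤ r)
    (hrR : ENNReal.ofReal r < R) : maxTerm a r ≤ ellTwoMean a r :=
  ciSup_le fun n => ha.term_le_ellTwoMean hr hrR n

lemma ellTwoMean_pos (ha : BoundedTerms a R) {N : ℕ} (hN : a N ≠ 0) {r : ℝ} (hr : 0 < r)
    (hrR : ENNReal.ofReal r < R) : 0 < ellTwoMean a r :=
  (by positivity : 0 < ‖a N‖ * r ^ N).trans_le (ha.term_le_ellTwoMean hr.le hrR N)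

end BoundedTerms

/-! ### Stability of S_f under geometric decay of the terms. -/

lemma one_add_pow_le_one_add_mul {y : ℝ} (hy : 0 ≤ y) (n : ℕ) :
    (1 + y) ^ n ≤ 1 + n * y * (1 + y) ^ n := by
  induction n with
  | zero => simp
  | succ n ih =>
    have h1 : 1 ≤ (1 + y) ^ (n + 1) := one_le_pow₀ (by linarith)
    have h2 : (1 + y) ^ n * (1 + y) ≤ (1 + n * y * (1 + y) ^ n) * (1 + y) := by gcongr
    push_cast
    rw [pow_succ] at h1 ⊢
    nlinarith

/-- If the terms `|a_n| r^n` decay at least like `(1 + δ)^{-n}` relative to `S_f(r)`, then `S_f`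
does not grow by more than a constant factor on `[r, r (1 + δ²/4)]`. -/
lemma ellTwoMean_le_of_geometric_decay {a : ℕ → ℂ} {R : ℝ≥0∞} (ha : BoundedTerms a R)
    {r δ B s : ℝ} (hr : 0 < r) (hδ : 0 < δ) (hδ1 : δ ≤ 1)
    (hdecay : ∀ n, ‖a n‖ * r ^ n * (1 + δ) ^ n ≤ B * ellTwoMean a r)
    (hs0 : 0 ≤ s) (hs : s ≤ r * (1 + δ ^ 2 / 4)) (hsR : ENNReal.ofReal s < R)
    (hrR : ENNReal.ofReal r < R) :
    ellTwoMean a s ≤ Real.sqrt (1 + 2 * B ^ 2) * ellTwoMean a r := by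
  have hS0 : 0 ≤ ellTwoMean a r := Real.sqrt_nonneg _
  set S := ellTwoMean a r with hS
  set y : ℝ := (1 + δ ^ 2 / 4) ^ 2 - 1 with hy
  have hδ2 : δ ^ 2 ≤ 1 := pow_le_one₀ hδ.le hδ1
  have hδδ : δ ^ 2 ≤ δ := by nlinarith
  have hy0 : 0 ≤ y := by rw [hy]; nlinarith [sq_nonneg δ]
  have hyδ : y ≤ δ ^ 2 := by rw [hy]; nlinarith [sq_nonneg δ]
  set q : ℝ := (1 + δ)⁻¹ with hq
  have hq0 : 0 < q := by positivity
  have hq1 : q < 1 := inv_lt_one_of_one_lt₀ (by linarith)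
  have hqn : ‖q‖ < 1 := by rwa [Real.norm_of_nonneg hq0.le]
  have hgeo : Summable fun n : ℕ => (n : ℝ) * q ^ n := by
    simpa using summable_pow_mul_geometric_of_norm_lt_one 1 hqn
  have hgeo_eq : ∑' n : ℕ, (n : ℝ) * q ^ n = (1 + δ) / δ ^ 2 := by
    have h1q : 1 - q = δ * q := by rw [hq]; field_simp; ring
    rw [tsum_coe_mul_geometric_of_norm_lt_one hqn, h1q, hq]
    field_simp
  -- The squared decay supplies q^{2n}. One factor q^n absorbs (1+y)^n, since 1+y ≤ 1+δ; the other
  -- leaves ∑ n q^n = (1+δ)/δ², which y ≤ δ² cancels. This is why the interval has relative length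
  -- of order δ² and not δ.
  have hterm : ∀ n, ‖a n‖ ^ 2 * s ^ (2 * n) ≤
      ‖a n‖ ^ 2 * r ^ (2 * n) + B ^ 2 * S ^ 2 * δ ^ 2 * (n * q ^ n) := by
    intro n
    have h1 : s ^ (2 * n) ≤ r ^ (2 * n) * (1 + y) ^ n := by
      calc s ^ (2 * n) ≤ (r * (1 + δ ^ 2 / 4)) ^ (2 * n) := by gcongr
        _ = r ^ (2 * n) * (1 + y) ^ n := by
          rw [hy, mul_pow, pow_mul (1 + δ ^ 2 / 4)]; congr 2; ring
    have h2 : ‖a n‖ * r ^ n ≤ B * S * q ^ n := by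
      rw [hq, inv_pow, ← div_eq_mul_inv, le_div_iff₀ (by positivity)]
      exact hdecay n
    have h3 : (‖a n‖ * r ^ n) ^ 2 ≤ (B * S * q ^ n) ^ 2 := by gcongr
    have h4 : (q * (1 + y)) ^ n ≤ 1 := by
      refine pow_le_one₀ (by positivity) ?_
      rw [hq, inv_mul_le_iff₀ (by positivity)]
      linarith
    calc ‖a n‖ ^ 2 * s ^ (2 * n) ≤ ‖a n‖ ^ 2 * (r ^ (2 * n) * (1 + n * y * (1 + y) ^ n)) := by
          gcongr
          exact h1.trans (by gcongr; exact one_add_pow_le_one_add_mul hy0 n)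
      _ = ‖a n‖ ^ 2 * r ^ (2 * n) + (‖a n‖ * r ^ n) ^ 2 * (n * y * (1 + y) ^ n) := by ring
      _ ≤ ‖a n‖ ^ 2 * r ^ (2 * n) + (B * S * q ^ n) ^ 2 * (n * δ ^ 2 * (1 + y) ^ n) := by gcongr
      _ = ‖a n‖ ^ 2 * r ^ (2 * n) + B ^ 2 * S ^ 2 * δ ^ 2 * (n * q ^ n) * (q * (1 + y)) ^ n := by
          rw [mul_pow q]; ring
      _ ≤ ‖a n‖ ^ 2 * r ^ (2 * n) + B ^ 2 * S ^ 2 * δ ^ 2 * (n * q ^ n) * 1 := by gcongr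
      _ = _ := by ring
  have hsq : ellTwoMean a s ^ 2 ≤ (1 + 2 * B ^ 2) * S ^ 2 := by
    rw [BoundedTerms.sq_ellTwoMean hs0]
    calc ∑' n, ‖a n‖ ^ 2 * s ^ (2 * n)
        ≤ ∑' n : ℕ, (‖a n‖ ^ 2 * r ^ (2 * n) + B ^ 2 * S ^ 2 * δ ^ 2 * (n * q ^ n)) :=
          (ha.summable_sq hs0 hsR).tsum_le_tsum hterm
            ((ha.summable_sq hr.le hrR).add (hgeo.mul_left _))
      _ = S ^ 2 + B ^ 2 * S ^ 2 * δ ^ 2 * ((1 + δ) / δ ^ 2) := by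
          rw [(ha.summable_sq hr.le hrR).tsum_add (hgeo.mul_left _), tsum_mul_left, hgeo_eq, hS,
            BoundedTerms.sq_ellTwoMean hr.le]
      _ = S ^ 2 + B ^ 2 * S ^ 2 * (1 + δ) := by field_simp
      _ ≤ S ^ 2 + B ^ 2 * S ^ 2 * (1 + 1) := by gcongr
      _ = _ := by ring
  refine le_of_sq_le_sq ?_ (by positivity)
  rwa [mul_pow, Real.sq_sqrt (by positivity)]

/-! ### The Borel-type growth lemma. -/

lemma exists_monotone_exhaustion {r₁ : ℝ} {R : ℝ≥0∞} (hr₁ : ENNReal.ofReal r₁ < R) :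
    ∃ u : ℕ → ℝ, Monotone u ∧ (∀ n, u n ∈ radii r₁ R) ∧
      ∀ r, ENNReal.ofReal r < R → ∃ n, r ≤ u n := by
  obtain ⟨v, hv, hvI, hvR⟩ := exists_seq_strictMono_tendsto' hr₁
  have htop : ∀ n, v n ≠ ∞ := fun n => ((hvI n).2.trans_le le_top).ne
  refine ⟨fun n => (v n).toReal, fun m n hmn => ENNReal.toReal_mono (htop n) (hv.monotone hmn),
    fun n => ⟨(ENNReal.ofReal_le_iff_le_toReal (htop n)).1 (hvI n).1.le, ?_⟩, fun r hr => ?_⟩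
  · rw [ENNReal.ofReal_toReal (htop n)]; exact (hvI n).2
  · obtain ⟨n, hn⟩ := ((tendsto_order.1 hvR).1 _ hr).exists
    exact ⟨n, (ENNReal.ofReal_le_iff_le_toReal (htop n)).1 hn.le⟩

lemma measurableSet_radii (ρ : ℝ) (R : ℝ≥0∞) : MeasurableSet (radii ρ R) :=
  measurableSet_Ici.inter (ENNReal.measurable_ofReal measurableSet_Iio)

lemma radii_anti {ρ r : ℝ} {R : ℝ≥0∞} (h : ρ ≤ r) : radii r R ⊆ radii ρ R :=
  fun _ hs => ⟨h.trans hs.1, hs.2⟩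

lemma Icc_subset_radii {ρ p q : ℝ} {R : ℝ≥0∞} (hp : ρ ≤ p) (hq : ENNReal.ofReal q < R) :
    Icc p q ⊆ radii ρ R := fun _ hx => ⟨hp.trans hx.1, ofReal_lt_of_le hx.2 hq⟩

lemma isOpen_Ioi_inter_radii (r₁ : ℝ) (R : ℝ≥0∞) :
    IsOpen {r : ℝ | r₁ < r ∧ ENNReal.ofReal r < R} :=
  isOpen_Ioi.inter (isOpen_Iio.preimage ENNReal.continuous_ofReal)

/-- A Borel-type growth lemma: off a set `E` of finite size, a monotone function `V ≥ 1` grows by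
at most `1` over intervals whose length, measured by `m`, is at most `V⁻²`. -/
lemma exists_isOpen_forall_notMem_le_add_one {r₁ : ℝ} {R : ℝ≥0∞} {m V : ℝ → ℝ} {g : ℝ → ℝ≥0∞}
    (hr₁ : ENNReal.ofReal r₁ < R)
    (hm : MonotoneOn m (radii r₁ R))
    (hivt : ∀ p ∈ radii r₁ R, ∀ M, m p ≤ M → ∃ q ∈ radii p R, m q = M)
    (hg : ∀ p q, r₁ ≤ p → p ≤ q → ENNReal.ofReal q < R →
      ∫⁻ r in Ioo p q, g r ≤ ENNReal.ofReal (m q - m p))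
    (hV : MonotoneOn V (radii r₁ R)) (hV1 : ∀ r ∈ radii r₁ R, 1 ≤ V r) :
    ∃ E : Set ℝ, IsOpen E ∧ E ⊆ radii r₁ R ∧ ∫⁻ r in E, g r < ∞ ∧
      ∀ r ∈ radii r₁ R, r₁ < r → r ∉ E → ∀ s ∈ radii r R, m s - m r ≤ 1 / V r ^ 2 →
        V s ≤ V r + 1 := by
  let Bad : ℕ → ℝ → Prop := fun k r => r ∈ radii r₁ R ∧ r₁ < r ∧ ⌊V r⌋₊ = k ∧
    ∃ s ∈ radii r R, m s - m r ≤ 1 / V r ^ 2 ∧ V r + 1 < V s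
  -- Bad points on the same level k = ⌊V⌋ are m-close: a witness s of the badness of r satisfies V s
  -- > V r + 1 ≥ k + 1 > V t, so it lies beyond t.
  have key : ∀ {k r t}, Bad k r → Bad k t → r ≤ t → m t - m r ≤ 1 / (k : ℝ) ^ 2 := by
    rintro k r t ⟨hr, hr1, hrk, s, hs, hms, hVs⟩ ⟨ht, ht1, htk, -⟩ hrt
    have hs' : s ∈ radii r₁ R := radii_anti hr.1 hs
    have hk1 : (k : ℝ) ≤ V r := hrk ▸ Nat.floor_le (zero_le_one.trans (hV1 r hr))
    have hk2 : V t < k + 1 := htk ▸ Nat.lt_floor_add_one (V t)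
    have hk : 0 < k := hrk ▸ Nat.floor_pos.2 (hV1 r hr)
    have hts : t ≤ s := by
      by_contra! hst
      have := hV hs' ht hst.le
      linarith
    calc m t - m r ≤ m s - m r := by linarith [hm ht hs' hts]
      _ ≤ 1 / V r ^ 2 := hms
      _ ≤ 1 / (k : ℝ) ^ 2 := by gcongr
  have hEk : ∀ k : ℕ, ∃ E : Set ℝ, IsOpen E ∧ E ⊆ radii r₁ R ∧ (∀ r, Bad k r → r ∈ E) ∧
      ∫⁻ r in E, g r ≤ ENNReal.ofReal (4 * (1 / (k : ℝ) ^ 2)) := by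
    intro k
    by_cases hbad : ∃ t, Bad k t
    swap
    · push Not at hbad
      exact ⟨∅, isOpen_empty, empty_subset _, fun r hr => absurd hr (hbad r), by simp⟩
    obtain ⟨t, htb⟩ := hbad
    have ht := htb.1
    have hk : 0 < k := htb.2.2.1 ▸ Nat.floor_pos.2 (hV1 t ht)
    set ε : ℝ := 1 / (k : ℝ) ^ 2 with hε
    have hε0 : 0 < ε := by positivity
    -- An m-radius 2ε, twice what closeness requires, makes the interval around `t` contain all bad
    -- points in its interior. On the left it may be cut at r₁, which is harmless since bad points
    -- exceed r₁ strictly. Its m-length is at most 4/k², which is summable.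
    obtain ⟨q, hq, hmq⟩ := hivt t ht (m t + 2 * ε) (by linarith)
    have hqr : q ∈ radii r₁ R := radii_anti ht.1 hq
    obtain ⟨p, hp, hpt, hmp, hp'⟩ : ∃ p ∈ radii r₁ R, p ≤ t ∧ m t - 2 * ε ≤ m p ∧
        (p = r₁ ∨ m p = m t - 2 * ε) := by
      rcases le_total (m r₁) (m t - 2 * ε) with hc | hc
      · obtain ⟨p, hp, hmp⟩ := hivt r₁ ⟨le_rfl, hr₁⟩ _ hc
        refine ⟨p, hp, ?_, hmp.ge, Or.inr hmp⟩
        by_contra! htp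
        linarith [hm ht hp htp.le]
      · exact ⟨r₁, ⟨le_rfl, hr₁⟩, ht.1, hc, Or.inl rfl⟩
    refine ⟨Ioo p q, isOpen_Ioo, Ioo_subset_Icc_self.trans (Icc_subset_radii hp.1 hq.2),
      fun r hrb => ?_, (hg p q hp.1 (hpt.trans hq.1) hq.2).trans
        (ENNReal.ofReal_le_ofReal (by linarith))⟩
    have hr := hrb.1
    have hclose : |m r - m t| ≤ ε := by
      rcases le_total r t with hrt | hrt
      · rw [abs_sub_comm, abs_of_nonneg (by linarith [hm hr ht hrt])]
        exact key hrb htb hrt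
      · rw [abs_of_nonneg (by linarith [hm ht hr hrt])]
        exact key htb hrb hrt
    rw [abs_le] at hclose
    constructor
    · rcases hp' with hp' | hp'
      · rw [hp']; exact hrb.2.1
      · by_contra! hrp
        linarith [hm hr hp hrp]
    · by_contra! hqr'
      linarith [hm hqr hr hqr']
  choose E hEo hEr hEb hEm using hEk
  refine ⟨⋃ k, E k, isOpen_iUnion hEo, iUnion_subset hEr, ?_, ?_⟩
  · calc ∫⁻ r in ⋃ k, E k, g r ≤ ∑' k, ∫⁻ r in E k, g r := lintegral_iUnion_le _ _
      _ ≤ ∑' k : ℕ, ENNReal.ofReal (4 * (1 / (k : ℝ) ^ 2)) := ENNReal.tsum_le_tsum hEm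
      _ = ENNReal.ofReal (∑' k : ℕ, 4 * (1 / (k : ℝ) ^ 2)) :=
        (ENNReal.ofReal_tsum_of_nonneg (fun k => by positivity)
          ((Real.summable_one_div_nat_pow.2 one_lt_two).mul_left 4)).symm
      _ < ∞ := ENNReal.ofReal_lt_top
  · intro r hr hr1 hrE s hs hms
    by_contra! hcon
    exact hrE (mem_iUnion.2 ⟨⌊V r⌋₊, hEb _ r ⟨hr, hr1, rfl, s, hs, hms, hcon⟩⟩)

/-! ### The primitive of h(t)/t, and decay of the terms off the exceptional set. -/

section LogPrimitive

variable {h : ℝ → ℝ} {r₁ : ℝ} {R : ℝ≥0∞}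

lemma intervalIntegrable_div_self (hr₁ : 0 < r₁) (hc : ContinuousOn h (radii r₁ R)) {p q : ℝ}
    (hp : p ∈ radii r₁ R) (hq : q ∈ radii r₁ R) :
    IntervalIntegrable (fun t => h t / t) volume p q := by
  have hsub : uIcc p q ⊆ radii r₁ R := fun x hx =>
    ⟨(le_min hp.1 hq.1).trans hx.1, ofReal_lt_of_le hx.2 (by
      rcases max_choice p q with h | h <;> rw [h]
      exacts [hp.2, hq.2])⟩
  exact ((hc.mono hsub).div continuousOn_id fun x hx =>
    (hr₁.trans_le (hsub hx).1).ne').intervalIntegrable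

lemma integral_sub_integral_div_self (hr₁ : 0 < r₁) (hr₁R : ENNReal.ofReal r₁ < R)
    (hc : ContinuousOn h (radii r₁ R)) {p q : ℝ} (hp : p ∈ radii r₁ R) (hq : q ∈ radii r₁ R) :
    (∫ t in r₁..q, h t / t) - ∫ t in r₁..p, h t / t = ∫ t in p..q, h t / t :=
  intervalIntegral.integral_interval_sub_left
    (intervalIntegrable_div_self hr₁ hc ⟨le_rfl, hr₁R⟩ hq)
    (intervalIntegrable_div_self hr₁ hc ⟨le_rfl, hr₁R⟩ hp)

lemma lintegral_Ioo_div_self (hr₁ : 0 < r₁)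
    (hc : ContinuousOn h (radii r₁ R)) (h0 : ∀ r ∈ radii r₁ R, 0 ≤ h r) {p q : ℝ}
    (hp : r₁ ≤ p) (hpq : p ≤ q) (hq : ENNReal.ofReal q < R) :
    ∫⁻ t in Ioo p q, ENNReal.ofReal (h t / t) = ENNReal.ofReal (∫ t in p..q, h t / t) := by
  have hi := intervalIntegrable_div_self hr₁ hc ⟨hp, ofReal_lt_of_le hpq hq⟩ ⟨hp.trans hpq, hq⟩
  rw [intervalIntegral.integral_of_le hpq, integral_Ioc_eq_integral_Ioo,
    ofReal_integral_eq_lintegral_ofReal]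
  · exact (intervalIntegrable_iff_integrableOn_Ioo_of_le hpq).1 hi
  · refine (ae_restrict_iff' measurableSet_Ioo).2 (Eventually.of_forall fun t ht => ?_)
    exact div_nonneg (h0 t (Icc_subset_radii hp hq (Ioo_subset_Icc_self ht)))
      (hr₁.le.trans (hp.trans ht.1.le))

lemma integral_div_self_unbounded (hr₁ : 0 < r₁) (hr₁R : ENNReal.ofReal r₁ < R)
    (hc : ContinuousOn h (radii r₁ R)) (h0 : ∀ r ∈ radii r₁ R, 0 ≤ h r)
    (htop : ∫⁻ t in radii r₁ R, ENNReal.ofReal (h t / t) = ∞) (M : ℝ) :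
    ∃ q ∈ radii r₁ R, M ≤ ∫ t in r₁..q, h t / t := by
  by_contra! hcon
  obtain ⟨u, hu, hur, hcof⟩ := exists_monotone_exhaustion hr₁R
  have hcover : radii r₁ R ⊆ ⋃ n, Icc r₁ (u n) := fun r hr => by
    obtain ⟨n, hn⟩ := hcof r hr.2
    exact mem_iUnion.2 ⟨n, hr.1, hn⟩
  have hdir : Directed (· ⊆ ·) fun n => Icc r₁ (u n) :=
    (monotone_nat_of_le_succ fun n => Icc_subset_Icc_right (hu n.le_succ)).directed_le
  have : ∫⁻ t in radii r₁ R, ENNReal.ofReal (h t / t) ≤ ENNReal.ofReal M := by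
    refine (lintegral_mono_set hcover).trans ?_
    rw [setLIntegral_iUnion_of_directed _ hdir]
    refine iSup_le fun n => ?_
    rw [setLIntegral_congr Ioo_ae_eq_Icc.symm,
      lintegral_Ioo_div_self hr₁ hc h0 le_rfl (hur n).1 (hur n).2]
    exact ENNReal.ofReal_le_ofReal (hcon _ (hur n)).le
  rw [htop] at this
  exact absurd (this.trans_lt ENNReal.ofReal_lt_top) (lt_irrefl _)

/-- Divergence of the integral makes the primitive unbounded, and the intermediate value theorem
does the rest. It is needed to step forward from any radius by a prescribed amount of logarithmic
measure without reaching R. -/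
lemma exists_integral_div_self_eq (hr₁ : 0 < r₁) (hr₁R : ENNReal.ofReal r₁ < R)
    (hc : ContinuousOn h (radii r₁ R)) (h0 : ∀ r ∈ radii r₁ R, 0 ≤ h r)
    (htop : ∫⁻ t in radii r₁ R, ENNReal.ofReal (h t / t) = ∞) {p : ℝ} (hp : p ∈ radii r₁ R)
    {M : ℝ} (hM : ∫ t in r₁..p, h t / t ≤ M) :
    ∃ q ∈ radii p R, ∫ t in r₁..q, h t / t = M := by
  obtain ⟨b, hb, hMb⟩ := integral_div_self_unbounded hr₁ hr₁R hc h0 htop M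
  have hmax : max p b ∈ radii r₁ R := by rcases max_choice p b with h | h <;> rwa [h]
  have hMb' : M ≤ ∫ t in r₁..max p b, h t / t := by
    have := integral_sub_integral_div_self hr₁ hr₁R hc hb hmax
    have h2 : 0 ≤ ∫ t in b..max p b, h t / t :=
      intervalIntegral.integral_nonneg (le_max_right _ _) fun t ht =>
        div_nonneg (h0 t (Icc_subset_radii hb.1 hmax.2 ht)) (hr₁.le.trans (hb.1.trans ht.1))
    linarith
  have hcont : ContinuousOn (fun q => ∫ t in r₁..q, h t / t) (Icc p (max p b)) := by
    have hii := intervalIntegrable_div_self hr₁ hc ⟨le_rfl, hr₁R⟩ hmax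
    have := intervalIntegral.continuousOn_primitive_interval
      ((intervalIntegrable_iff_integrableOn_Icc_of_le hmax.1).1 hii |>.congr_set_ae
        (by rw [uIcc_of_le hmax.1]; exact EventuallyEq.rfl))
    rw [uIcc_of_le hmax.1] at this
    exact this.mono (Icc_subset_Icc_left hp.1)
  obtain ⟨q, hq, hqM⟩ := intermediate_value_Icc (le_max_left p b) hcont ⟨hM, hMb'⟩
  exact ⟨q, ⟨hq.1, ofReal_lt_of_le hq.2 hmax.2⟩, hqM⟩

end LogPrimitive

/-- Off an open set of finite `h`-logarithmic measure the terms `|a_n| r^n` decay geometrically,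
at a rate controlled by `h(r)` and `log (h(r) μ_f(r))`. -/
lemma exists_isOpen_forall_notMem_geometric_decay {a : ℕ → ℂ} {h : ℝ → ℝ} {r₁ : ℝ} {R : ℝ≥0∞}
    (ha : BoundedTerms a R) (hr₁ : 0 < r₁) (hr₁R : ENNReal.ofReal r₁ < R)
    (hc : ContinuousOn h (radii r₁ R)) (hmono : MonotoneOn h (radii r₁ R))
    (h1 : ∀ r ∈ radii r₁ R, 1 ≤ h r) (hμ : ∀ r ∈ radii r₁ R, Real.exp 1 ≤ h r * maxTerm a r)
    (htop : ∫⁻ t in radii r₁ R, ENNReal.ofReal (h t / t) = ∞) :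
    ∃ E : Set ℝ, IsOpen E ∧ E ⊆ radii r₁ R ∧ ∫⁻ t in E, ENNReal.ofReal (h t / t) < ∞ ∧
      ∀ r ∈ radii r₁ R, r₁ < r → r ∉ E → ∀ δ : ℝ,
        δ = 1 / (Real.exp 1 * h r * Real.log (h r * maxTerm a r) ^ 2) →
        ENNReal.ofReal (r * (1 + δ)) < R ∧
          ∀ n, ‖a n‖ * r ^ n * (1 + δ) ^ n ≤ Real.exp 1 * maxTerm a r := by
  have h0 : ∀ r ∈ radii r₁ R, 0 ≤ h r := fun r hr => zero_le_one.trans (h1 r hr)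
  have hμpos : ∀ r ∈ radii r₁ R, 0 < maxTerm a r := fun r hr =>
    pos_of_mul_pos_right ((Real.exp_pos 1).trans_le (hμ r hr)) (h0 r hr)
  have hprod : ∀ r ∈ radii r₁ R, 0 < h r * maxTerm a r := fun r hr =>
    (Real.exp_pos 1).trans_le (hμ r hr)
  set m : ℝ → ℝ := fun q => ∫ t in r₁..q, h t / t with hm
  set V : ℝ → ℝ := fun r => Real.log (h r * maxTerm a r) with hVdef
  have hV1 : ∀ r ∈ radii r₁ R, 1 ≤ V r := fun r hr =>
    (Real.le_log_iff_exp_le (hprod r hr)).2 (hμ r hr)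
  have hV : MonotoneOn V (radii r₁ R) := fun r hr s hs hrs => by
    refine Real.log_le_log (hprod r hr) ?_
    exact mul_le_mul (hmono hr hs hrs) (ha.maxTerm_mono (hr₁.le.trans hr.1) hrs hs.2)
      (hμpos r hr).le (h0 s hs)
  have hdiff : ∀ {p q}, p ∈ radii r₁ R → q ∈ radii r₁ R →
      m q - m p = ∫ t in p..q, h t / t := fun hp hq =>
    integral_sub_integral_div_self hr₁ hr₁R hc hp hq
  have hmm : MonotoneOn m (radii r₁ R) := fun p hp q hq hpq => by
    rw [← sub_nonneg, hdiff hp hq]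
    exact intervalIntegral.integral_nonneg hpq fun t ht =>
      div_nonneg (h0 t (Icc_subset_radii hp.1 hq.2 ht)) (hr₁.le.trans (hp.1.trans ht.1))
  obtain ⟨E, hEo, hEr, hEm, hE⟩ := exists_isOpen_forall_notMem_le_add_one (m := m) (V := V)
    (g := fun t => ENNReal.ofReal (h t / t)) hr₁R hmm
    (fun p hp M hM => exists_integral_div_self_eq hr₁ hr₁R hc h0 htop hp hM)
    (fun p q hp hpq hq => by
      rw [lintegral_Ioo_div_self hr₁ hc h0 hp hpq hq,
        hdiff ⟨hp, ofReal_lt_of_le hpq hq⟩ ⟨hp.trans hpq, hq⟩]) hV hV1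
  refine ⟨E, hEo, hEr, hEm, fun r hr hr1 hrE δ hδ => ?_⟩
  have hr0 : 0 < r := hr₁.trans hr1
  have hVr := hV1 r hr
  have hhr := h1 r hr
  have he := Real.exp_pos 1
  have hVpos : 0 < V r := one_pos.trans_le hVr
  -- This s is the farthest point that the growth lemma controls from r: V rises by at most 1 up to
  -- s, so h μ_f grows at most by a factor e. Both factors are monotone, hence each of them
  -- separately grows at most by e.
  obtain ⟨s, hs, hms⟩ := exists_integral_div_self_eq hr₁ hr₁R hc h0 htop hr
    (M := m r + 1 / V r ^ 2) (by simp only [hm]; linarith [show 0 < 1 / V r ^ 2 by positivity])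
  have hs' : s ∈ radii r₁ R := radii_anti hr.1 hs
  have hms' : m s - m r = 1 / V r ^ 2 := by rw [show m s = _ from hms]; ring
  have hVs := hE r hr hr1 hrE s hs hms'.le
  have hgrow : h s * maxTerm a s ≤ Real.exp 1 * (h r * maxTerm a r) := by
    have := Real.exp_le_exp.2 hVs
    rwa [Real.exp_add, Real.exp_log (hprod s hs'), Real.exp_log (hprod r hr),
      mul_comm (h r * _)] at this
  have hhs : h r ≤ h s := hmono hr hs' hs.1
  have hμs : maxTerm a r ≤ maxTerm a s := ha.maxTerm_mono hr0.le hs.1 hs.2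
  have hh_le : h s ≤ Real.exp 1 * h r := by
    refine le_of_mul_le_mul_right ?_ (hμpos r hr)
    calc h s * maxTerm a r ≤ h s * maxTerm a s := by gcongr; exact h0 s hs'
      _ ≤ _ := by rw [mul_assoc]; exact hgrow
  have hμ_le : maxTerm a s ≤ Real.exp 1 * maxTerm a r := by
    refine le_of_mul_le_mul_left ?_ (one_pos.trans_le hhr)
    calc h r * maxTerm a s ≤ h s * maxTerm a s := by gcongr; exact (hμpos s hs').le
      _ ≤ _ := by rw [mul_left_comm]; exact hgrow
  -- Since h ≤ e h(r) on [r, s], a logarithmic measure of 1/V² forces s − r ≥ r δ.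
  have hint : 1 / V r ^ 2 ≤ Real.exp 1 * h r / r * (s - r) := by
    rw [← hms', hdiff hr hs']
    calc ∫ t in r..s, h t / t ≤ ∫ _t in r..s, Real.exp 1 * h r / r := by
          refine intervalIntegral.integral_mono_on hs.1 (intervalIntegrable_div_self hr₁ hc hr hs')
            (by simp) fun t ht => ?_
          have ht' : t ∈ radii r₁ R := Icc_subset_radii hr.1 hs.2 ht
          have : h t ≤ Real.exp 1 * h r := (hmono ht' hs' ht.2).trans hh_le
          have : 0 ≤ Real.exp 1 * h r := by positivity
          gcongr
          exact ht.1
      _ = _ := by rw [intervalIntegral.integral_const, smul_eq_mul]; ring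
  have hle : r * (1 + δ) ≤ s := by
    have hV' : V r = Real.log (h r * maxTerm a r) := rfl
    rw [hδ, ← hV']
    have : 1 / (Real.exp 1 * h r * V r ^ 2) ≤ (s - r) / r := by
      rw [div_le_iff₀ (by positivity)]
      calc (1 : ℝ) = 1 / V r ^ 2 * V r ^ 2 := by field_simp
        _ ≤ Real.exp 1 * h r / r * (s - r) * V r ^ 2 := by gcongr
        _ = _ := by ring
    calc r * (1 + 1 / (Real.exp 1 * h r * V r ^ 2)) ≤ r * (1 + (s - r) / r) := by gcongr
      _ = s := by field_simp; ring
  have hδ0 : 0 < δ := by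
    have hV' : V r = Real.log (h r * maxTerm a r) := rfl
    rw [hδ, ← hV']; positivity
  have hR := ofReal_lt_of_le hle hs.2
  refine ⟨hR, fun n => ?_⟩
  calc ‖a n‖ * r ^ n * (1 + δ) ^ n = ‖a n‖ * (r * (1 + δ)) ^ n := by rw [mul_pow]; ring
    _ ≤ maxTerm a (r * (1 + δ)) := ha.term_le_maxTerm (by positivity) hR n
    _ ≤ maxTerm a s := ha.maxTerm_mono (by positivity) hle hs.2
    _ ≤ _ := hμ_le

/-! ### Subgaussian variables and their moments. -/

/-- Used with centred variables: the linear term integrates to zero and only the square remains in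
the exponent. -/
lemma exp_le_add_exp_sq (x : ℝ) : Real.exp x ≤ x + Real.exp (x ^ 2) := by
  have h1 := Real.add_one_le_exp (x ^ 2)
  rcases le_total |x| 1 with hx | hx
  · have := (abs_le.1 (Real.abs_exp_sub_one_sub_id_le hx)).2
    linarith
  · rcases le_abs.1 hx with hx | hx
    · have : Real.exp x ≤ Real.exp (x ^ 2) := Real.exp_le_exp.2 (by nlinarith)
      linarith
    · have : Real.exp x ≤ 1 := Real.exp_le_one_iff.2 (by linarith)
      nlinarith

lemma norm_le_exp_sq {lam : ℝ} (hlam : 0 < lam) (x : ℂ) :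
    ‖x‖ ≤ 1 / lam * Real.exp (lam * ‖x‖ ^ 2) + 1 := by
  have h1 := Real.add_one_le_exp (lam * ‖x‖ ^ 2)
  have h2 : ‖x‖ ^ 2 ≤ 1 / lam * Real.exp (lam * ‖x‖ ^ 2) := by
    rw [one_div, le_inv_mul_iff₀ hlam]
    linarith
  nlinarith [sq_nonneg (‖x‖ - 1 / 2)]

section Subgaussian

variable {Ω : Type*} [MeasurableSpace Ω] {P : Measure Ω} [IsProbabilityMeasure P]

/-- Layer-cake formula. With 1/(2τ²), half of the exponent in the tail, the level sets at height t >
1 have probability at most K t⁻², which integrates to K; the heights t ≤ 1 contribute at most 1. -/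
lemma lintegral_exp_sq_le_of_tail {X : Ω → ℂ} (hX : Measurable X) {K τ : ℝ} (hK : 0 < K)
    (hτ : 0 < τ) (htail : ∀ t : ℝ, 0 ≤ t →
      P {ω | t < ‖X ω‖} ≤ ENNReal.ofReal (K * Real.exp (-(t ^ 2 / τ ^ 2)))) :
    ∫⁻ ω, ENNReal.ofReal (Real.exp (‖X ω‖ ^ 2 / (2 * τ ^ 2))) ∂P ≤ ENNReal.ofReal (1 + K) := by
  rw [lintegral_eq_lintegral_meas_lt P (Eventually.of_forall fun ω => (Real.exp_pos _).le)
    (by fun_prop), ← Ioc_union_Ioi_eq_Ioi (zero_le_one (α := ℝ)),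
    ENNReal.ofReal_add zero_le_one hK.le]
  refine (lintegral_union_le _ _ _).trans (add_le_add ?_ ?_)
  · calc ∫⁻ t in Ioc (0 : ℝ) 1, P {ω | t < Real.exp (‖X ω‖ ^ 2 / (2 * τ ^ 2))}
        ≤ ∫⁻ _t in Ioc (0 : ℝ) 1, 1 := lintegral_mono fun t => prob_le_one
      _ = _ := by simp
  · have hint : IntegrableOn (fun t : ℝ => K * t ^ (-2 : ℝ)) (Ioi 1) :=
      (integrableOn_Ioi_rpow_of_lt (by norm_num) one_pos).const_mul K
    calc ∫⁻ t in Ioi (1 : ℝ), P {ω | t < Real.exp (‖X ω‖ ^ 2 / (2 * τ ^ 2))}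
        ≤ ∫⁻ t in Ioi (1 : ℝ), ENNReal.ofReal (K * t ^ (-2 : ℝ)) := by
          refine setLIntegral_mono' measurableSet_Ioi fun t ht => ?_
          have ht1 : (1 : ℝ) < t := ht
          have ht0 : 0 < t := one_pos.trans ht1
          have hlog : 0 ≤ Real.log t := Real.log_nonneg ht1.le
          refine (measure_mono fun ω hω => ?_).trans
            ((htail (Real.sqrt (2 * τ ^ 2 * Real.log t)) (Real.sqrt_nonneg _)).trans_eq ?_)
          · rw [mem_ofPred_eq, ← Real.log_lt_iff_lt_exp ht0, lt_div_iff₀ (by positivity)] at hω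
            rw [mem_ofPred_eq, Real.sqrt_lt' ?_]
            · linarith
            · rw [norm_pos_iff]
              rintro h0
              rw [h0] at hω
              have : 0 ≤ Real.log t * (2 * τ ^ 2) := by positivity
              simp at hω
              linarith
          · rw [Real.sq_sqrt (by positivity), Real.rpow_def_of_pos ht0]
            congr 3
            field_simp
      _ = ENNReal.ofReal (∫ t in Ioi (1 : ℝ), K * t ^ (-2 : ℝ)) := by
          refine (ofReal_integral_eq_lintegral_ofReal hint ?_).symm
          refine (ae_restrict_iff' measurableSet_Ioi).2 (Eventually.of_forall fun t ht => ?_)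
          have ht0 : (0 : ℝ) < t := one_pos.trans ht
          positivity
      _ = ENNReal.ofReal K := by
          rw [integral_const_mul, integral_Ioi_rpow_of_lt (by norm_num) one_pos]
          norm_num

lemma hasSubgaussianMGF_re_mul {X : Ω → ℂ} (hX : Measurable X) {lam K : ℝ} (hK : 0 < K)
    (hlam : 0 < lam) (hexp : ∫⁻ ω, ENNReal.ofReal (Real.exp (lam * ‖X ω‖ ^ 2)) ∂P
      ≤ ENNReal.ofReal (1 + K)) (hX0 : ∫ ω, X ω ∂P = 0) (b : ℂ) :
    HasSubgaussianMGF (fun ω => (b * X ω).re)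
      (Real.toNNReal (2 * ((1 / 4 + K) / lam) * ‖b‖ ^ 2)) P := by
  have hint : Integrable (fun ω => Real.exp (lam * ‖X ω‖ ^ 2)) P :=
    ⟨by fun_prop, by
      rw [hasFiniteIntegral_iff_ofReal (Eventually.of_forall fun ω => (Real.exp_pos _).le)]
      exact hexp.trans_lt ENNReal.ofReal_lt_top⟩
  have hA : ∫ ω, Real.exp (lam * ‖X ω‖ ^ 2) ∂P ≤ 1 + K := by
    rw [integral_eq_lintegral_of_nonneg_ae (Eventually.of_forall fun ω => (Real.exp_pos _).le)
      (by fun_prop)]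
    exact ENNReal.toReal_le_of_le_ofReal (by linarith) hexp
  have hpt : ∀ (b x : ℂ), (b * x).re ≤ ‖b‖ ^ 2 / (4 * lam) + lam * ‖x‖ ^ 2 := fun b x => by
    have h1 : (b * x).re ≤ ‖b‖ * ‖x‖ := (Complex.re_le_norm _).trans (norm_mul _ _).le
    have h2 : ‖b‖ ^ 2 / (4 * lam) + lam * ‖x‖ ^ 2 - ‖b‖ * ‖x‖ =
        (‖b‖ - 2 * lam * ‖x‖) ^ 2 / (4 * lam) := by field_simp; ring
    have h3 : 0 ≤ (‖b‖ - 2 * lam * ‖x‖) ^ 2 / (4 * lam) := by positivity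
    linarith
  have hb_int : ∀ b : ℂ, Integrable (fun ω => Real.exp (b * X ω).re) P := fun b => by
    refine (hint.const_mul (Real.exp (‖b‖ ^ 2 / (4 * lam)))).mono' (by fun_prop)
      (Eventually.of_forall fun ω => ?_)
    rw [Real.norm_of_nonneg (Real.exp_pos _).le, ← Real.exp_add]
    exact Real.exp_le_exp.2 (hpt _ _)
  have hX_int : Integrable X P := by
    refine Integrable.mono' ((hint.const_mul (1 / lam)).add (integrable_const 1)) (by fun_prop)
      (Eventually.of_forall fun ω => ?_)
    exact norm_le_exp_sq hlam _
  have hb_le : ∀ b : ℂ, ∫ ω, Real.exp (b * X ω).re ∂P ≤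
      Real.exp ((1 / 4 + K) / lam * ‖b‖ ^ 2) := fun b => by
    -- For small b, e^x ≤ x + e^{x²} is combined with convexity of exp between 0 and λ‖X‖², and the
    -- mean zero removes the linear term. For large b centring is not needed: b X is split by the
    -- arithmetic-geometric inequality, and 1 + K ≤ e^K ≤ e^{K‖b‖²/λ}.
    rcases le_total (‖b‖ ^ 2) lam with hb | hb
    · have hbl : ‖b‖ ^ 2 / lam ≤ 1 := (div_le_one hlam).2 hb
      have hconv : ∀ x : ℂ, Real.exp (b * x).re ≤ (b * x).re +
          (1 + ‖b‖ ^ 2 / lam * (Real.exp (lam * ‖x‖ ^ 2) - 1)) := fun x => by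
        have h1 := exp_le_add_exp_sq (b * x).re
        have h2 : (b * x).re ^ 2 ≤ ‖b‖ ^ 2 * ‖x‖ ^ 2 := by
          rw [← mul_pow, ← norm_mul]
          exact sq_le_sq.2 ((Complex.abs_re_le_norm _).trans (le_abs_self _))
        have h3 := convexOn_exp.2 (mem_univ 0) (mem_univ (lam * ‖x‖ ^ 2))
          (sub_nonneg.2 hbl) (by positivity : 0 ≤ ‖b‖ ^ 2 / lam) (by ring)
        have h4 : (1 - ‖b‖ ^ 2 / lam) • (0 : ℝ) + (‖b‖ ^ 2 / lam) • (lam * ‖x‖ ^ 2) =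
            ‖b‖ ^ 2 * ‖x‖ ^ 2 := by simp only [smul_eq_mul]; field_simp; ring
        rw [h4] at h3
        simp only [smul_eq_mul, Real.exp_zero] at h3
        have h5 := Real.exp_le_exp.2 h2
        linarith
      have hre : ∫ ω, (b * X ω).re ∂P = 0 := by
        have := integral_re (𝕜 := ℂ) (hX_int.const_mul b)
        simp only [RCLike.re_to_complex] at this
        rw [this, integral_const_mul, hX0]
        simp
      have hre_int : Integrable (fun ω => (b * X ω).re) P := (hX_int.const_mul b).re
      have hsub : Integrable (fun ω => ‖b‖ ^ 2 / lam * (Real.exp (lam * ‖X ω‖ ^ 2) - 1)) P :=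
        (hint.sub (integrable_const 1)).const_mul _
      have hrest : Integrable (fun ω => 1 + ‖b‖ ^ 2 / lam * (Real.exp (lam * ‖X ω‖ ^ 2) - 1)) P :=
        (integrable_const 1).add hsub
      calc ∫ ω, Real.exp (b * X ω).re ∂P
          ≤ ∫ ω, ((b * X ω).re + (1 + ‖b‖ ^ 2 / lam * (Real.exp (lam * ‖X ω‖ ^ 2) - 1))) ∂P :=
            integral_mono (hb_int b) (hre_int.add hrest) fun ω => hconv _
        _ = 1 + ‖b‖ ^ 2 / lam * (∫ ω, Real.exp (lam * ‖X ω‖ ^ 2) ∂P - 1) := by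
            rw [integral_add hre_int hrest, hre, zero_add, integral_add (integrable_const 1)
              hsub, integral_const_mul,
              integral_sub hint (integrable_const 1)]
            simp
        _ ≤ 1 + ‖b‖ ^ 2 / lam * K := by gcongr; linarith
        _ ≤ Real.exp (‖b‖ ^ 2 / lam * K) := by linarith [Real.add_one_le_exp (‖b‖ ^ 2 / lam * K)]
        _ ≤ _ := by
            refine Real.exp_le_exp.2 ?_
            have : 0 ≤ 1 / 4 / lam * ‖b‖ ^ 2 := by positivity
            calc ‖b‖ ^ 2 / lam * K ≤ ‖b‖ ^ 2 / lam * K + 1 / 4 / lam * ‖b‖ ^ 2 := by linarith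
              _ = _ := by ring
    · have hbl : 1 ≤ ‖b‖ ^ 2 / lam := (one_le_div hlam).2 hb
      calc ∫ ω, Real.exp (b * X ω).re ∂P
          ≤ ∫ ω, Real.exp (‖b‖ ^ 2 / (4 * lam)) * Real.exp (lam * ‖X ω‖ ^ 2) ∂P := by
            refine integral_mono (hb_int b) (hint.const_mul _) fun ω => ?_
            simp only
            rw [← Real.exp_add]
            exact Real.exp_le_exp.2 (hpt _ _)
        _ ≤ Real.exp (‖b‖ ^ 2 / (4 * lam)) * Real.exp K := by
            rw [integral_const_mul]
            gcongr
            linarith [Real.add_one_le_exp K]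
        _ ≤ _ := by
            rw [← Real.exp_add]
            refine Real.exp_le_exp.2 ?_
            have : K * 1 ≤ K * (‖b‖ ^ 2 / lam) := by gcongr
            calc ‖b‖ ^ 2 / (4 * lam) + K ≤ ‖b‖ ^ 2 / (4 * lam) + K * (‖b‖ ^ 2 / lam) := by linarith
              _ = _ := by field_simp
  have hscale : ∀ (t : ℝ) (ω : Ω), t * (b * X ω).re = ((t * b : ℂ) * X ω).re := fun t ω => by
    rw [mul_assoc, Complex.re_ofReal_mul]
  constructor
  · intro t
    simp_rw [hscale]
    exact hb_int _
  · intro t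
    simp only [mgf, hscale]
    refine (hb_le _).trans_eq ?_
    rw [Real.coe_toNNReal _ (by positivity), norm_mul, Complex.norm_real, mul_pow, Real.norm_eq_abs,
      sq_abs]
    ring_nf

omit [IsProbabilityMeasure P] in
lemma lintegral_even_pow_le {Y : Ω → ℝ} {c : NNReal} (hY : HasSubgaussianMGF Y c P) {D : ℝ}
    (hD : 0 < D) (hcD : c ≤ 2 * D) {k : ℕ} (hk : 1 ≤ k) :
    ∫⁻ ω, ENNReal.ofReal (Y ω ^ (2 * k)) ∂P ≤
      ENNReal.ofReal (2 * (4 * Real.exp 1 * D * k) ^ k) := by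
  have hk0 : (0 : ℝ) < k := by exact_mod_cast hk
  -- This choice gives c t²/2 ≤ k, so both exponential moments are at most e^k while t^{2k} =
  -- (k/D)^k.
  set t : ℝ := Real.sqrt (k / D) with ht
  have ht2 : t ^ 2 = k / D := Real.sq_sqrt (by positivity)
  have ht0 : 0 < t := Real.sqrt_pos.2 (by positivity)
  set q : ℝ := ((2 * k).factorial : ℝ) / t ^ (2 * k) with hq
  have hq0 : 0 ≤ q := by positivity
  have hpt : ∀ y : ℝ, y ^ (2 * k) ≤ q * (Real.exp (t * y) + Real.exp (-t * y)) := fun y => by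
    have h1 := Real.pow_div_factorial_le_exp |t * y| (abs_nonneg _) (2 * k)
    have h2 : Real.exp |t * y| ≤ Real.exp (t * y) + Real.exp (-t * y) := by
      rw [neg_mul]; exact Real.exp_abs_le _
    rw [(even_two_mul k).pow_abs, mul_pow, div_le_iff₀ (by positivity)] at h1
    rw [hq, div_mul_eq_mul_div, le_div_iff₀ (by positivity)]
    calc y ^ (2 * k) * t ^ (2 * k) = t ^ (2 * k) * y ^ (2 * k) := mul_comm _ _
      _ ≤ _ := h1
      _ ≤ _ := by rw [mul_comm]; gcongr
  have hint : Integrable (fun ω => q * (Real.exp (t * Y ω) + Real.exp (-t * Y ω))) P :=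
    ((hY.integrable_exp_mul t).add (hY.integrable_exp_mul (-t))).const_mul q
  have hmgf : ∀ u : ℝ, u ^ 2 = k / D → ∫ ω, Real.exp (u * Y ω) ∂P ≤ Real.exp 1 ^ k := fun u hu => by
    refine (hY.mgf_le u).trans ?_
    rw [← Real.exp_nat_mul, hu]
    refine Real.exp_le_exp.2 ?_
    calc (c : ℝ) * (k / D) / 2 ≤ (2 * D) * (k / D) / 2 := by gcongr
      _ = k * 1 := by field_simp
  calc ∫⁻ ω, ENNReal.ofReal (Y ω ^ (2 * k)) ∂P
      ≤ ∫⁻ ω, ENNReal.ofReal (q * (Real.exp (t * Y ω) + Real.exp (-t * Y ω))) ∂P :=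
        lintegral_mono fun ω => ENNReal.ofReal_le_ofReal (hpt _)
    _ = ENNReal.ofReal (∫ ω, q * (Real.exp (t * Y ω) + Real.exp (-t * Y ω)) ∂P) :=
        (ofReal_integral_eq_lintegral_ofReal hint
          (Eventually.of_forall fun ω => by positivity)).symm
    _ ≤ _ := by
        refine ENNReal.ofReal_le_ofReal ?_
        rw [integral_const_mul, integral_add (hY.integrable_exp_mul t) (hY.integrable_exp_mul (-t))]
        have h1 := hmgf t ht2
        have h2 := hmgf (-t) (by rw [neg_sq, ht2])
        have hfact : ((2 * k).factorial : ℝ) ≤ (2 * k : ℝ) ^ (2 * k) := by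
          exact_mod_cast Nat.factorial_le_pow (2 * k)
        calc q * (∫ ω, Real.exp (t * Y ω) ∂P + ∫ ω, Real.exp (-t * Y ω) ∂P)
            ≤ ((2 * k : ℝ) ^ (2 * k) / t ^ (2 * k)) * (Real.exp 1 ^ k + Real.exp 1 ^ k) := by
              rw [hq]; gcongr
          _ = 2 * (4 * Real.exp 1 * D * k) ^ k := by
              rw [pow_mul t, ht2, pow_mul (2 * k : ℝ), ← div_pow, ← two_mul, mul_left_comm,
                ← mul_pow]
              congr 2
              field_simp
              ring

lemma lintegral_enorm_sum_pow_le {X : ℕ → Ω → ℂ} (hX : ∀ n, Measurable (X n))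
    (hind : iIndepFun X P) {lam K : ℝ} (hK : 0 < K) (hlam : 0 < lam)
    (hexp : ∀ n, ∫⁻ ω, ENNReal.ofReal (Real.exp (lam * ‖X n ω‖ ^ 2)) ∂P ≤ ENNReal.ofReal (1 + K))
    (hX0 : ∀ n, ∫ ω, X n ω ∂P = 0) (b : ℕ → ℂ) (s : Finset ℕ) {T : ℝ} (hT : 0 < T)
    (hbT : ∑ n ∈ s, ‖b n‖ ^ 2 ≤ T) {k : ℕ} (hk : 1 ≤ k) :
    ∫⁻ ω, ‖∑ n ∈ s, b n * X n ω‖ₑ ^ (2 * k) ∂P ≤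
      ENNReal.ofReal (4 * (8 * Real.exp 1 * ((1 / 4 + K) / lam) * T * k) ^ k) := by
  set σ : ℝ := (1 / 4 + K) / lam with hσ
  have hσ0 : 0 < σ := by positivity
  have hre : ∀ b : ℕ → ℂ, ∑ n ∈ s, ‖b n‖ ^ 2 ≤ T →
      ∫⁻ ω, ENNReal.ofReal ((∑ n ∈ s, b n * X n ω).re ^ (2 * k)) ∂P ≤
        ENNReal.ofReal (2 * (4 * Real.exp 1 * (σ * T) * k) ^ k) := fun b hbT => by
    have hsum := HasSubgaussianMGF.sum_of_iIndepFun (s := s)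
      (X := fun n ω => (b n * X n ω).re)
      (hind.comp (fun n x => (b n * x).re) fun n => by fun_prop)
      (fun n _ => hasSubgaussianMGF_re_mul (hX n) hK hlam (hexp n) (hX0 n) (b n))
    have := lintegral_even_pow_le hsum (D := σ * T) (by positivity) (by
      rw [NNReal.coe_sum]
      calc ∑ n ∈ s, ((Real.toNNReal (2 * σ * ‖b n‖ ^ 2) : NNReal) : ℝ)
          = ∑ n ∈ s, 2 * σ * ‖b n‖ ^ 2 :=
            Finset.sum_congr rfl fun n _ => Real.coe_toNNReal _ (by positivity)
        _ ≤ 2 * (σ * T) := by rw [← Finset.mul_sum, ← mul_assoc]; gcongr) hk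
    simpa only [Complex.re_sum] using this
  -- The imaginary part is the real part after multiplication by −i, which leaves ‖b n‖ unchanged,
  -- so the real bound serves twice.
  have hsplit : ∀ w : ℂ, ‖w‖ₑ ^ (2 * k) ≤ ENNReal.ofReal (2 ^ k) *
      (ENNReal.ofReal (w.re ^ (2 * k)) + ENNReal.ofReal ((-Complex.I * w).re ^ (2 * k))) := by
    intro w
    have h1 : (-Complex.I * w).re = w.im := by simp
    rw [h1, ← ofReal_norm, ← ENNReal.ofReal_pow (norm_nonneg _),
      ← ENNReal.ofReal_add ((even_two_mul k).pow_nonneg _) ((even_two_mul k).pow_nonneg _),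
      ← ENNReal.ofReal_mul (by positivity)]
    refine ENNReal.ofReal_le_ofReal ?_
    rw [pow_mul, pow_mul, pow_mul, Complex.sq_norm, Complex.normSq_apply, ← sq, ← sq]
    refine (add_pow_le (sq_nonneg _) (sq_nonneg _) k).trans ?_
    gcongr
    · norm_num
    · omega
  have hI : ∀ ω, -Complex.I * ∑ n ∈ s, b n * X n ω = ∑ n ∈ s, (-Complex.I * b n) * X n ω :=
    fun ω => by rw [Finset.mul_sum]; simp only [mul_assoc]
  calc ∫⁻ ω, ‖∑ n ∈ s, b n * X n ω‖ₑ ^ (2 * k) ∂P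
      ≤ ∫⁻ ω, ENNReal.ofReal (2 ^ k) * (ENNReal.ofReal ((∑ n ∈ s, b n * X n ω).re ^ (2 * k)) +
          ENNReal.ofReal ((∑ n ∈ s, (-Complex.I * b n) * X n ω).re ^ (2 * k))) ∂P :=
        lintegral_mono fun ω => by
          have := hsplit (∑ n ∈ s, b n * X n ω)
          rwa [hI] at this
    _ ≤ ENNReal.ofReal (2 ^ k) * (ENNReal.ofReal (2 * (4 * Real.exp 1 * (σ * T) * k) ^ k) +
          ENNReal.ofReal (2 * (4 * Real.exp 1 * (σ * T) * k) ^ k)) := by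
        rw [lintegral_const_mul _ (by fun_prop), lintegral_add_left (by fun_prop)]
        gcongr
        · exact hre b hbT
        · refine hre _ ?_
          simpa using hbT
    _ = _ := by
        rw [← ENNReal.ofReal_add (by positivity) (by positivity),
          ← ENNReal.ofReal_mul (by positivity)]
        congr 1
        rw [show 8 * Real.exp 1 * σ * T * k = 2 * (4 * Real.exp 1 * (σ * T) * k) by ring,
          mul_pow 2]
        ring

/-- Almost surely a sequence with uniformly bounded exponential square moments grows at most
quadratically. -/
lemma ae_exists_norm_le_mul_sq {X : ℕ → Ω → ℂ} (hX : ∀ n, Measurable (X n)) {lam K : ℝ}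
    (hlam : 0 < lam)
    (hexp : ∀ n, ∫⁻ ω, ENNReal.ofReal (Real.exp (lam * ‖X n ω‖ ^ 2)) ∂P ≤ ENNReal.ofReal (1 + K)) :
    ∀ᵐ ω ∂P, ∃ C : ℝ, 0 ≤ C ∧ ∀ n : ℕ, ‖X n ω‖ ≤ C * ((n : ℝ) + 1) ^ 2 := by
  set B : ℝ≥0∞ := ENNReal.ofReal (1 / lam) * ENNReal.ofReal (1 + K) + 1 with hB
  have hBtop : B ≠ ∞ := by
    rw [hB]
    exact ENNReal.add_ne_top.2 ⟨ENNReal.mul_ne_top ENNReal.ofReal_ne_top ENNReal.ofReal_ne_top,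
      ENNReal.one_ne_top⟩
  have hmean : ∀ n, ∫⁻ ω, ENNReal.ofReal ‖X n ω‖ ∂P ≤ B := fun n => by
    calc ∫⁻ ω, ENNReal.ofReal ‖X n ω‖ ∂P
        ≤ ∫⁻ ω, (ENNReal.ofReal (1 / lam) * ENNReal.ofReal (Real.exp (lam * ‖X n ω‖ ^ 2)) + 1) ∂P :=
          lintegral_mono fun ω => by
            rw [← ENNReal.ofReal_mul (by positivity), ← ENNReal.ofReal_one,
              ← ENNReal.ofReal_add (by positivity) zero_le_one]
            exact ENNReal.ofReal_le_ofReal (norm_le_exp_sq hlam _)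
      _ ≤ B := by
          rw [lintegral_add_right _ measurable_const, lintegral_const_mul _ (by fun_prop)]
          simp only [lintegral_const, measure_univ, mul_one, hB]
          gcongr
          exact hexp n
  have hw : Summable fun n : ℕ => 1 / ((n : ℝ) + 1) ^ 2 := by
    simpa using (summable_nat_add_iff 1).2 (Real.summable_one_div_nat_pow.2 one_lt_two)
  -- The means of |X_n| are uniformly bounded, so ∑ |X_n|/(n+1)² has finite mean; almost surely it
  -- is finite and dominates each of its terms.
  have hfin : ∫⁻ ω, ∑' n : ℕ, ENNReal.ofReal (1 / ((n : ℝ) + 1) ^ 2) * ENNReal.ofReal ‖X n ω‖ ∂P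
      ≠ ∞ := by
    rw [lintegral_tsum fun n => by fun_prop]
    refine ne_top_of_le_ne_top (ENNReal.mul_ne_top hw.tsum_ofReal_ne_top hBtop) ?_
    rw [← ENNReal.tsum_mul_right]
    refine ENNReal.tsum_le_tsum fun n => ?_
    rw [lintegral_const_mul _ (by fun_prop)]
    gcongr
    exact hmean n
  have hmeas : Measurable fun ω =>
      ∑' n : ℕ, ENNReal.ofReal (1 / ((n : ℝ) + 1) ^ 2) * ENNReal.ofReal ‖X n ω‖ :=
    Measurable.tsum fun n => by fun_prop
  filter_upwards [ae_lt_top hmeas hfin] with ω hω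
  refine ⟨(∑' n : ℕ, ENNReal.ofReal (1 / ((n : ℝ) + 1) ^ 2) * ENNReal.ofReal ‖X n ω‖).toReal,
    ENNReal.toReal_nonneg, fun n => ?_⟩
  have h1 := ENNReal.le_tsum (f := fun n : ℕ =>
    ENNReal.ofReal (1 / ((n : ℝ) + 1) ^ 2) * ENNReal.ofReal ‖X n ω‖) n
  rw [← ENNReal.ofReal_mul (by positivity), ENNReal.ofReal_le_iff_le_toReal hω.ne,
    one_div_mul_eq_div, div_le_iff₀ (by positivity)] at h1
  exact h1

end Subgaussian

/-! ### Convergence and moments of the random series. -/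

lemma isOpen_openDisc (R : ℝ≥0∞) : IsOpen (openDisc R) :=
  isOpen_Iio.preimage (ENNReal.continuous_ofReal.comp continuous_norm)

lemma openDisc_of_norm_le {R : ℝ≥0∞} {z : ℂ} {s : ℝ} (hz : ‖z‖ ≤ s) (hs : ENNReal.ofReal s < R) :
    z ∈ openDisc R := ofReal_lt_of_le hz hs

section Series

variable {Ω : Type*} {a : ℕ → ℂ} {R : ℝ≥0∞} {X : ℕ → Ω → ℂ} {ω : Ω} {C : ℝ}

lemma norm_term_le_of_growth (hX : ∀ n : ℕ, ‖X n ω‖ ≤ C * ((n : ℝ) + 1) ^ 2) {z : ℂ}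
    {s : ℝ} (hz : ‖z‖ ≤ s) (n : ℕ) :
    ‖a n * X n ω * z ^ n‖ ≤ C * (((n : ℝ) + 1) ^ 2 * (‖a n‖ * s ^ n)) := by
  rw [norm_mul, norm_mul, norm_pow]
  have h0 : 0 ≤ C * ((n : ℝ) + 1) ^ 2 := (norm_nonneg _).trans (hX n)
  calc ‖a n‖ * ‖X n ω‖ * ‖z‖ ^ n ≤ ‖a n‖ * (C * ((n : ℝ) + 1) ^ 2) * s ^ n := by
        gcongr; exact hX n
    _ = _ := by ring

lemma summable_of_growth (ha : BoundedTerms a R)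
    (hX : ∀ n : ℕ, ‖X n ω‖ ≤ C * ((n : ℝ) + 1) ^ 2) {z : ℂ} (hz : z ∈ openDisc R) :
    Summable fun n => a n * X n ω * z ^ n :=
  Summable.of_norm_bounded ((ha.summable_sq_mul (norm_nonneg z) hz).mul_left C)
    fun n => norm_term_le_of_growth hX le_rfl n

lemma differentiableOn_randomSeries (ha : BoundedTerms a R)
    (hX : ∀ n : ℕ, ‖X n ω‖ ≤ C * ((n : ℝ) + 1) ^ 2) :
    DifferentiableOn ℂ (randomSeries a X ω) (openDisc R) := by
  intro z hz
  obtain ⟨s, hzs, hs, hsR⟩ := exists_radius_between (r := ‖z‖) hz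
  have := Complex.differentiableOn_tsum_of_summable_norm (U := Metric.ball (0 : ℂ) s)
    (F := fun n z => a n * X n ω * z ^ n) ((ha.summable_sq_mul hs.le hsR).mul_left C)
    (fun n => by fun_prop) Metric.isOpen_ball
    (fun n w hw => norm_term_le_of_growth hX (mem_ball_zero_iff.1 hw).le n)
  exact (this.differentiableAt (Metric.isOpen_ball.mem_nhds
    (mem_ball_zero_iff.2 hzs))).differentiableWithinAt

end Series

/-- Fatou's lemma carries the bound over from partial sums, whose ℓ² norms are at most S_f(‖z‖). -/
lemma lintegral_enorm_randomSeries_pow_le {Ω : Type*} [MeasurableSpace Ω] {P : Measure Ω}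
    [IsProbabilityMeasure P] {a : ℕ → ℂ} {R : ℝ≥0∞} (ha : BoundedTerms a R)
    {X : ℕ → Ω → ℂ} (hX : ∀ n, Measurable (X n))
    (hind : iIndepFun X P) {lam K : ℝ} (hK : 0 < K) (hlam : 0 < lam)
    (hexp : ∀ n, ∫⁻ ω, ENNReal.ofReal (Real.exp (lam * ‖X n ω‖ ^ 2)) ∂P ≤ ENNReal.ofReal (1 + K))
    (hX0 : ∀ n, ∫ ω, X n ω ∂P = 0) {z : ℂ} (hz : z ∈ openDisc R)
    (hS : 0 < ellTwoMean a ‖z‖) {k : ℕ} (hk : 1 ≤ k) :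
    ∫⁻ ω, ‖randomSeries a X ω z‖ₑ ^ (2 * k) ∂P ≤ ENNReal.ofReal
      (4 * (8 * Real.exp 1 * ((1 / 4 + K) / lam) * ellTwoMean a ‖z‖ ^ 2 * k) ^ k) := by
  have hlim : ∀ᵐ ω ∂P, ‖randomSeries a X ω z‖ₑ ^ (2 * k) =
      liminf (fun N => ‖∑ n ∈ Finset.range N, (a n * z ^ n) * X n ω‖ₑ ^ (2 * k)) atTop := by
    filter_upwards [ae_exists_norm_le_mul_sq hX hlam hexp] with ω hω
    obtain ⟨C, -, hC⟩ := hω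
    have h1 := (summable_of_growth ha hC hz).hasSum.tendsto_sum_nat
    have h2 := ((ENNReal.continuous_pow (2 * k)).comp continuous_enorm).tendsto _ |>.comp h1
    refine (h2.congr fun N => ?_).liminf_eq.symm
    simp only [Function.comp_apply]
    congr 2
    exact Finset.sum_congr rfl fun n _ => by ring
  rw [lintegral_congr_ae hlim]
  refine (lintegral_liminf_le fun N => by fun_prop).trans ?_
  refine (liminf_le_liminf (v := fun _ => ENNReal.ofReal
    (4 * (8 * Real.exp 1 * ((1 / 4 + K) / lam) * ellTwoMean a ‖z‖ ^ 2 * k) ^ k))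
    (Eventually.of_forall fun N => ?_)).trans_eq (liminf_const _)
  refine lintegral_enorm_sum_pow_le hX hind hK hlam hexp hX0 _ _ (by positivity) ?_ hk
  rw [BoundedTerms.sq_ellTwoMean (norm_nonneg z)]
  refine le_trans (Finset.sum_le_sum fun n _ => ?_)
    ((ha.summable_sq (norm_nonneg z) hz).sum_le_tsum (Finset.range N) fun n _ => by positivity)
  rw [norm_mul, norm_pow]
  exact le_of_eq (by ring)

/-- By Tonelli the sum over k of the ν-integrals has finite mean, so one random number bounds them
all. This replaces a union bound over points and over k. -/
lemma ae_exists_lintegral_le {Ω T : Type*} [MeasurableSpace Ω] [MeasurableSpace T] {P : Measure Ω}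
    [SFinite P] {ν : Measure T} [IsFiniteMeasure ν] {G : ℕ → Ω → T → ℝ≥0∞}
    (hG : ∀ k, Measurable (Function.uncurry (G k))) {c : ℕ → ℝ≥0∞} (hc : ∑' k, c k ≠ ∞)
    (hb : ∀ k, ∀ᵐ t ∂ν, ∫⁻ ω, G k ω t ∂P ≤ c k) :
    ∀ᵐ ω ∂P, ∃ J : ℝ, 0 ≤ J ∧ ∀ k, ∫⁻ t, G k ω t ∂ν ≤ ENNReal.ofReal J := by
  have hmeas : ∀ k, Measurable fun ω => ∫⁻ t, G k ω t ∂ν := fun k =>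
    (hG k).lintegral_prod_right'
  have hfin : ∫⁻ ω, ∑' k, ∫⁻ t, G k ω t ∂ν ∂P ≠ ∞ := by
    rw [lintegral_tsum fun k => (hmeas k).aemeasurable]
    refine ne_top_of_le_ne_top (ENNReal.mul_ne_top hc (measure_ne_top ν univ)) ?_
    rw [← ENNReal.tsum_mul_right]
    refine ENNReal.tsum_le_tsum fun k => ?_
    rw [lintegral_lintegral_swap (hG k).aemeasurable, ← lintegral_const]
    exact lintegral_mono_ae (hb k)
  filter_upwards [ae_lt_top (Measurable.tsum hmeas) hfin] with ω hω
  refine ⟨(∑' k, ∫⁻ t, G k ω t ∂ν).toReal, ENNReal.toReal_nonneg, fun k => ?_⟩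
  rw [ENNReal.ofReal_toReal hω.ne]
  exact ENNReal.le_tsum k

/-! ### Cauchy estimates on circles and annuli. -/

lemma enorm_le_lintegral_circle {g : ℂ → ℂ} {s : ℝ} {z : ℂ} (hz : ‖z‖ < s)
    (hg : DifferentiableOn ℂ g (Metric.closedBall 0 s)) :
    ‖g z‖ₑ ≤ ENNReal.ofReal (s / (s - ‖z‖) / (2 * Real.pi)) *
      ∫⁻ θ in Ioc 0 (2 * Real.pi), ‖g (circleMap 0 s θ)‖ₑ := by
  have hs : 0 < s := (norm_nonneg z).trans_lt hz
  have hsz : 0 < s - ‖z‖ := sub_pos.2 hz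
  rw [← closure_ball (0 : ℂ) hs.ne'] at hg
  have hC := hg.diffContOnCl.two_pi_i_inv_smul_circleIntegral_sub_inv_smul (mem_ball_zero_iff.2 hz)
  rw [← hC, enorm_smul, circleIntegral, intervalIntegral.integral_of_le Real.two_pi_pos.le]
  have h1 : ‖(2 * (Real.pi : ℂ) * Complex.I)⁻¹‖ₑ = ENNReal.ofReal (1 / (2 * Real.pi)) := by
    rw [← ofReal_norm]
    congr 1
    simp [abs_of_pos Real.pi_pos]
  have h2 : ∀ θ : ℝ, ‖deriv (circleMap 0 s) θ • ((circleMap 0 s θ - z)⁻¹ • g (circleMap 0 s θ))‖ₑ ≤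
      ENNReal.ofReal (s / (s - ‖z‖)) * ‖g (circleMap 0 s θ)‖ₑ := fun θ => by
    rw [smul_smul, enorm_smul]
    gcongr
    rw [← ofReal_norm]
    refine ENNReal.ofReal_le_ofReal ?_
    have hn : ‖circleMap 0 s θ‖ = s := by rw [norm_circleMap_zero, abs_of_pos hs]
    have hd : ‖deriv (circleMap 0 s) θ‖ = s := by
      rw [deriv_circleMap, norm_mul, hn, Complex.norm_I, mul_one]
    have hsub : s - ‖z‖ ≤ ‖circleMap 0 s θ - z‖ := by
      have := norm_sub_norm_le (circleMap 0 s θ) z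
      rwa [hn] at this
    rw [norm_mul, hd, norm_inv, div_eq_mul_inv]
    gcongr
  calc ‖(2 * (Real.pi : ℂ) * Complex.I)⁻¹‖ₑ * ‖∫ θ in Ioc 0 (2 * Real.pi),
        deriv (circleMap 0 s) θ • ((circleMap 0 s θ - z)⁻¹ • g (circleMap 0 s θ))‖ₑ
      ≤ ENNReal.ofReal (1 / (2 * Real.pi)) * ∫⁻ θ in Ioc 0 (2 * Real.pi),
          ENNReal.ofReal (s / (s - ‖z‖)) * ‖g (circleMap 0 s θ)‖ₑ := by
        rw [h1]
        gcongr
        exact (enorm_integral_le_lintegral_enorm _).trans (lintegral_mono h2)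
    _ = _ := by
        rw [lintegral_const_mul' _ _ ENNReal.ofReal_ne_top, ← mul_assoc,
          ← ENNReal.ofReal_mul (by positivity)]
        congr 2
        ring

/-- The moments are controlled only after integration in the radius, so Cauchy's bound is averaged
over radii. One factor 1/η comes from the kernel, as the circles stay at distance at least η‖z‖ from
z, and one from the width of the annulus. -/
lemma enorm_le_lintegral_annulus {g : ℂ → ℂ} {R : ℝ≥0∞} (hg : DifferentiableOn ℂ g (openDisc R))
    {z : ℂ} {η : ℝ} (hz : z ≠ 0) (hη : 0 < η) (hη1 : η ≤ 1)
    (hR : ENNReal.ofReal (‖z‖ * (1 + 2 * η)) < R) :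
    ‖g z‖ₑ ≤ ENNReal.ofReal (1 / (η ^ 2 * ‖z‖)) *
      ∫⁻ s in Ioo (‖z‖ * (1 + η)) (‖z‖ * (1 + 2 * η)), ∫⁻ θ in Ioc 0 (2 * Real.pi),
        ‖g (circleMap 0 s θ)‖ₑ := by
  have hr : 0 < ‖z‖ := norm_pos_iff.2 hz
  set r := ‖z‖ with hrdef
  have hpt : ∀ s ∈ Ioo (r * (1 + η)) (r * (1 + 2 * η)), ‖g z‖ₑ ≤
      ENNReal.ofReal (1 / η) * ∫⁻ θ in Ioc 0 (2 * Real.pi), ‖g (circleMap 0 s θ)‖ₑ := fun s hs => by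
    have hrs : r * η ≤ s - r := by linarith [hs.1]
    have hrη : 0 < r * η := by positivity
    have hs0 : 0 < s := by linarith
    refine (enorm_le_lintegral_circle (z := z) (s := s) (by rw [← hrdef]; linarith)
      (hg.mono fun w hw => openDisc_of_norm_le (mem_closedBall_zero_iff.1 hw)
        (ofReal_lt_of_le hs.2.le hR))).trans ?_
    refine mul_le_mul_left (ENNReal.ofReal_le_ofReal ?_) _
    rw [div_div, ← hrdef, div_le_div_iff₀ (by have := Real.pi_pos; nlinarith) hη]
    have h3 : s ≤ 3 * r := by nlinarith [hs.2]
    have hpi := Real.pi_gt_three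
    calc s * η ≤ 3 * r * η := by gcongr
      _ = (r * η) * 3 := by ring
      _ ≤ (s - r) * (2 * Real.pi) := by
        have : 3 ≤ 2 * Real.pi := by linarith
        have := hrη.le.trans hrs
        gcongr
      _ = _ := by ring
  have hint : ENNReal.ofReal (r * η) * ‖g z‖ₑ ≤ ENNReal.ofReal (1 / η) *
      ∫⁻ s in Ioo (r * (1 + η)) (r * (1 + 2 * η)), ∫⁻ θ in Ioc 0 (2 * Real.pi),
        ‖g (circleMap 0 s θ)‖ₑ := by
    rw [← lintegral_const_mul' _ _ ENNReal.ofReal_ne_top]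
    refine le_trans (le_of_eq ?_) (setLIntegral_mono' measurableSet_Ioo hpt)
    rw [setLIntegral_const, Real.volume_Ioo, mul_comm]
    congr 2
    ring
  calc ‖g z‖ₑ = ENNReal.ofReal (1 / (r * η)) * (ENNReal.ofReal (r * η) * ‖g z‖ₑ) := by
        rw [← mul_assoc, ← ENNReal.ofReal_mul (by positivity),
          one_div_mul_cancel (by positivity), ENNReal.ofReal_one, one_mul]
    _ ≤ ENNReal.ofReal (1 / (r * η)) * (ENNReal.ofReal (1 / η) *
      ∫⁻ s in Ioo (r * (1 + η)) (r * (1 + 2 * η)), ∫⁻ θ in Ioc 0 (2 * Real.pi),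
        ‖g (circleMap 0 s θ)‖ₑ) := by gcongr
    _ = _ := by
        rw [← mul_assoc, ← ENNReal.ofReal_mul (by positivity)]
        congr 2
        field_simp

/-! ### A finite measure in polar coordinates. -/

/-- The weight `s ↦ 1 / (s (1 + log² s))`, which is integrable at infinity. -/
noncomputable def logSqWeight (s : ℝ) : ℝ := (1 + Real.log s ^ 2)⁻¹ * s⁻¹

/-- The weight is the derivative of the bounded function arctan ∘ log. -/
lemma lintegral_logSqWeight_lt_top {r₁ : ℝ} (hr₁ : 0 < r₁) :
    ∫⁻ s in Ioi r₁, ENNReal.ofReal (logSqWeight s) < ∞ := by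
  have hd : ∀ s ∈ Ici r₁, HasDerivAt (fun s => Real.arctan (Real.log s)) (logSqWeight s) s :=
    fun s hs => by
      have := (Real.hasDerivAt_log (hr₁.trans_le hs).ne').arctan
      rwa [one_div] at this
  have hi := integrableOn_Ioi_deriv_of_nonneg' hd
    (fun s hs => by
      have : 0 < s := hr₁.trans hs
      unfold logSqWeight; positivity)
    ((Real.tendsto_arctan_atTop.mono_right nhdsWithin_le_nhds).comp Real.tendsto_log_atTop)
  exact hi.lintegral_lt_top

lemma measurable_logSqWeight : Measurable logSqWeight := by unfold logSqWeight; fun_prop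

lemma measurable_ellTwoMean (a : ℕ → ℂ) : Measurable (ellTwoMean a) :=
  (Measurable.tsum fun n => by fun_prop).sqrt

lemma measurable_randomSeries {Ω : Type*} [MeasurableSpace Ω] {a : ℕ → ℂ} {X : ℕ → Ω → ℂ}
    (hX : ∀ n, Measurable (X n)) :
    Measurable (Function.uncurry fun (ω : Ω) (z : ℂ) => randomSeries a X ω z) :=
  Measurable.tsum fun n => by
    have : Measurable fun p : Ω × ℂ => X n p.1 := (hX n).comp measurable_fst
    fun_prop

/-- The measure `ds dθ / (s (1 + log² s))` on polar coordinates in the annulus `r₁ ≤ s < R`. -/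
noncomputable def polarMeasure (r₁ : ℝ) (R : ℝ≥0∞) : Measure (ℝ × ℝ) :=
  ((volume.restrict (radii r₁ R)).withDensity fun s => ENNReal.ofReal (logSqWeight s)).prod
    (volume.restrict (Ioc 0 (2 * Real.pi)))

lemma isFiniteMeasure_polarMeasure {r₁ : ℝ} (hr₁ : 0 < r₁) (R : ℝ≥0∞) :
    IsFiniteMeasure (polarMeasure r₁ R) := by
  have : IsFiniteMeasure ((volume.restrict (radii r₁ R)).withDensity
      fun s => ENNReal.ofReal (logSqWeight s)) := by
    refine isFiniteMeasure_withDensity (ne_of_lt ?_)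
    refine lt_of_le_of_lt (lintegral_mono_set (t := Ioi (r₁ / 2)) fun s hs => ?_)
      (lintegral_logSqWeight_lt_top (half_pos hr₁))
    exact (half_lt_self hr₁).trans_le hs.1
  unfold polarMeasure
  infer_instance

lemma lintegral_polarMeasure {r₁ : ℝ} {R : ℝ≥0∞} {f : ℝ × ℝ → ℝ≥0∞} (hf : Measurable f) :
    ∫⁻ p, f p ∂(polarMeasure r₁ R) = ∫⁻ s in radii r₁ R, ENNReal.ofReal (logSqWeight s) *
      ∫⁻ θ in Ioc 0 (2 * Real.pi), f (s, θ) := by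
  rw [polarMeasure, lintegral_prod _ hf.aemeasurable, lintegral_withDensity_eq_lintegral_mul _
    measurable_logSqWeight.ennreal_ofReal hf.lintegral_prod_right']
  rfl

lemma ae_polarMeasure_of_forall {r₁ : ℝ} {R : ℝ≥0∞} {p : ℝ × ℝ → Prop}
    (h : ∀ s ∈ radii r₁ R, ∀ θ, p (s, θ)) : ∀ᵐ t ∂(polarMeasure r₁ R), p t := by
  have h1 : ∀ᵐ s ∂((volume.restrict (radii r₁ R)).withDensity
      fun s => ENNReal.ofReal (logSqWeight s)), s ∈ radii r₁ R :=
    (withDensity_absolutelyContinuous _ _).ae_le (ae_restrict_mem (measurableSet_radii r₁ R))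
  have h2 : ∀ᵐ t ∂(polarMeasure r₁ R), t.1 ∈ radii r₁ R :=
    Measure.quasiMeasurePreserving_fst.ae h1
  filter_upwards [h2] with t ht
  exact h _ ht _

/-! ### From integrated moments to a pointwise bound. -/

/-- The pathwise estimate: finiteness of all polar moments bounds `F` on `|z| = r`, as soon as the
terms `|a_n| r^n` decay geometrically at the rate `δ`. -/
lemma norm_le_of_polar_moments {a : ℕ → ℂ} {R : ℝ≥0∞} (ha : BoundedTerms a R) {F : ℂ → ℂ}
    (hF : DifferentiableOn ℂ F (openDisc R)) {r₁ δ H V B c J : ℝ} {z : ℂ} (hr₁ : 0 < r₁)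
    (hz : r₁ ≤ ‖z‖) (hS : ∀ s ∈ radii r₁ R, 0 < ellTwoMean a s) (hH : 1 ≤ H) (hV : 1 ≤ V)
    (hδ : δ = 1 / (Real.exp 1 * H * V ^ 2)) (hR : ENNReal.ofReal (‖z‖ * (1 + δ)) < R)
    (hdecay : ∀ n, ‖a n‖ * ‖z‖ ^ n * (1 + δ) ^ n ≤ Real.exp 1 * ellTwoMean a ‖z‖)
    (hc : 0 ≤ c)
    (hlog : ∀ s, ‖z‖ ≤ s → s ≤ 2 * ‖z‖ → ENNReal.ofReal s < R → |Real.log s| ≤ c + V)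
    (hB : 0 < B) (hJ0 : 0 ≤ J)
    (hJ : ∀ k : ℕ, 1 ≤ k → ∫⁻ s in radii r₁ R, ENNReal.ofReal (logSqWeight s) *
      ∫⁻ θ in Ioc 0 (2 * Real.pi), ENNReal.ofReal (1 / (B * k * ellTwoMean a s ^ 2) ^ k) *
        ‖F (circleMap 0 s θ)‖ₑ ^ (2 * k) ≤ ENNReal.ofReal J)
    (hφ : Real.exp 1 ≤ H * V)
    (hφJ : 128 * (1 + (c + 1) ^ 2) * Real.exp 1 ^ 4 * J ≤ H * V) :
    ‖F z‖ ≤ Real.sqrt (2 * Real.exp 1 ^ 11 * B * (1 + 2 * Real.exp 1 ^ 2)) *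
      Real.sqrt (Real.log (H * V)) * ellTwoMean a ‖z‖ := by
  have he := Real.exp_pos 1
  have he1 : 1 ≤ Real.exp 1 := Real.one_le_exp zero_le_one
  set r := ‖z‖ with hr
  have hr0 : 0 < r := hr₁.trans_le hz
  have hz0 : z ≠ 0 := norm_pos_iff.1 hr0
  have hδ0 : 0 < δ := by rw [hδ]; positivity
  have hδ1 : δ ≤ 1 := by
    rw [hδ, div_le_one (by positivity)]
    have : 1 ≤ V ^ 2 := one_le_pow₀ hV
    calc (1 : ℝ) = 1 * 1 * 1 := by ring
      _ ≤ _ := by gcongr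
  have hδδ : δ ^ 2 ≤ δ := by nlinarith
  have hrR : ENNReal.ofReal r < R := ofReal_lt_of_le (by nlinarith) hR
  -- The outer radius r(1+2η) is then r(1+δ²/4), the end of the interval on which S_f is stable.
  set η : ℝ := δ ^ 2 / 8 with hη
  have hη0 : 0 < η := by positivity
  have hη1 : η ≤ 1 := by rw [hη]; linarith
  have hηδ : r * (1 + 2 * η) ≤ r * (1 + δ) := by
    have : 2 * η ≤ δ := by rw [hη]; linarith
    gcongr
  have hηR := ofReal_lt_of_le hηδ hR
  set S := ellTwoMean a r with hSdef
  have hS0 : 0 < S := hS r ⟨hz, hrR⟩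
  set C₀ : ℝ := 1 + 2 * Real.exp 1 ^ 2 with hC₀
  have hC₀0 : 0 < C₀ := by positivity
  set φ := H * V with hφdef
  have hφ0 : 0 < φ := he.trans_le hφ
  have hL1 : 1 ≤ Real.log φ := (Real.le_log_iff_exp_le hφ0).2 hφ
  -- Large enough that φ ≤ e^k, so powers of φ disappear under the k-th root, and at most 2 log φ,
  -- so the factor k yields the logarithm in the bound.
  set k := ⌈Real.log φ⌉₊ with hk
  have hk1 : 1 ≤ k := Nat.one_le_iff_ne_zero.2 (Nat.ceil_pos.2 (by linarith)).ne'
  have hk0 : (0 : ℝ) < k := by exact_mod_cast hk1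
  have hkL : (k : ℝ) ≤ 2 * Real.log φ := by
    have := (Nat.ceil_lt_add_one (zero_le_one.trans hL1)).le
    linarith
  set c' : ℝ := 1 + (c + 1) ^ 2 with hc'
  have hc'0 : 0 < c' := by positivity
  -- The price of inserting the normalisation and the weight: A is at least (B k S_f(s)²)^k divided
  -- by the weight, throughout the annulus.
  set A : ℝ := (B * k * (C₀ * S ^ 2)) ^ k * (2 * r * (c' * V ^ 2)) with hA
  have hA0 : 0 < A := by positivity
  have hsub : Ioo (r * (1 + η)) (r * (1 + 2 * η)) ⊆ radii r₁ R := fun s hs =>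
    ⟨hz.trans (le_trans (by nlinarith) hs.1.le), ofReal_lt_of_le hs.2.le hηR⟩
  have hpt : ∀ s ∈ Ioo (r * (1 + η)) (r * (1 + 2 * η)),
      ∫⁻ θ in Ioc 0 (2 * Real.pi), ‖(F ^ (2 * k)) (circleMap 0 s θ)‖ₑ ≤
        ENNReal.ofReal A * (ENNReal.ofReal (logSqWeight s) *
          ∫⁻ θ in Ioc 0 (2 * Real.pi), ENNReal.ofReal (1 / (B * k * ellTwoMean a s ^ 2) ^ k) *
            ‖F (circleMap 0 s θ)‖ₑ ^ (2 * k)) := fun s hs => by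
    have hsr := hsub hs
    have hrs : r ≤ s := le_trans (by nlinarith) hs.1.le
    have hs0 : 0 < s := hr0.trans_le hrs
    have hs2 : s ≤ 2 * r := hs.2.le.trans (by nlinarith)
    have hSs := hS s hsr
    have hSle : ellTwoMean a s ^ 2 ≤ C₀ * S ^ 2 := by
      have := ellTwoMean_le_of_geometric_decay ha hr0 hδ0 hδ1 hdecay hs0.le
        (hs.2.le.trans (le_of_eq (by rw [hη]; ring))) hsr.2 hrR
      calc ellTwoMean a s ^ 2 ≤ (Real.sqrt C₀ * S) ^ 2 := by gcongr
        _ = _ := by rw [mul_pow, Real.sq_sqrt hC₀0.le]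
    have hw : 1 / (2 * r * (c' * V ^ 2)) ≤ logSqWeight s := by
      rw [logSqWeight, ← mul_inv, ← one_div]
      refine one_div_le_one_div_of_le (by positivity) ?_
      have h1 : Real.log s ^ 2 ≤ ((c + 1) * V) ^ 2 := by
        rw [← sq_abs]
        have : c + V ≤ (c + 1) * V := by nlinarith
        gcongr
        exact (hlog s hrs hs2 hsr.2).trans this
      have h2 : 1 ≤ V ^ 2 := one_le_pow₀ hV
      calc (1 + Real.log s ^ 2) * s ≤ (V ^ 2 + ((c + 1) * V) ^ 2) * (2 * r) := by gcongr
        _ = _ := by rw [hc']; ring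
    have hone : 1 ≤ A * logSqWeight s * (1 / (B * k * ellTwoMean a s ^ 2) ^ k) := by
      rw [mul_one_div, one_le_div (by positivity)]
      calc (B * k * ellTwoMean a s ^ 2) ^ k ≤ (B * k * (C₀ * S ^ 2)) ^ k := by gcongr
        _ = A * (1 / (2 * r * (c' * V ^ 2))) := by rw [hA]; field_simp
        _ ≤ A * logSqWeight s := by gcongr
    have hw0 : 0 ≤ logSqWeight s := le_trans (by positivity) hw
    rw [← lintegral_const_mul' _ _ ENNReal.ofReal_ne_top,
      ← lintegral_const_mul' _ _ ENNReal.ofReal_ne_top]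
    refine lintegral_mono fun θ => ?_
    rw [← mul_assoc, ← mul_assoc, ← ENNReal.ofReal_mul hA0.le,
      ← ENNReal.ofReal_mul (by positivity), Pi.pow_apply, enorm_pow]
    exact le_mul_of_one_le_left' (by rwa [ENNReal.one_le_ofReal])
  have hmain : ‖F z‖ₑ ^ (2 * k) ≤
      ENNReal.ofReal (1 / (η ^ 2 * r)) * (ENNReal.ofReal A * ENNReal.ofReal J) := by
    rw [← enorm_pow, ← Pi.pow_apply]
    refine (enorm_le_lintegral_annulus (hF.pow (2 * k)) hz0 hη0 hη1 hηR).trans ?_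
    gcongr
    refine (setLIntegral_mono' measurableSet_Ioo hpt).trans ?_
    rw [lintegral_const_mul' _ _ ENNReal.ofReal_ne_top]
    gcongr
    exact (lintegral_mono_set hsub).trans (hJ k hk1)
  rw [← ofReal_norm, ← ENNReal.ofReal_pow (norm_nonneg _), ← ENNReal.ofReal_mul hA0.le,
    ← ENNReal.ofReal_mul (by positivity), ENNReal.ofReal_le_ofReal_iff (by positivity)] at hmain
  have hφk : φ ≤ Real.exp 1 ^ k := by
    rw [← Real.exp_nat_mul, mul_one, ← Real.log_le_iff_le_exp hφ0]
    exact Nat.le_ceil _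
  -- The cost is 64 e⁴ H⁴ V⁸ from 1/η² and 2c'V² from A, times J. By `hφJ` the constants and J
  -- together fit into one factor φ, and H⁴V¹⁰ ≤ φ¹⁰; in total φ¹¹ ≤ e^{11k}.
  have hpow : ‖F z‖ ^ (2 * k) ≤ (Real.exp 1 ^ 11 * (B * k * (C₀ * S ^ 2))) ^ k := by
    have hη2 : 1 / η ^ 2 = 64 * Real.exp 1 ^ 4 * H ^ 4 * V ^ 8 := by
      rw [hη, hδ]; field_simp; norm_num
    calc ‖F z‖ ^ (2 * k) ≤ 1 / (η ^ 2 * r) * (A * J) := hmain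
      _ = (128 * c' * Real.exp 1 ^ 4 * J) * (H ^ 4 * V ^ 10) * (B * k * (C₀ * S ^ 2)) ^ k := by
          rw [one_div, mul_inv, ← one_div (η ^ 2), hη2, hA]; field_simp; ring
      _ ≤ φ * (H ^ 10 * V ^ 10) * (B * k * (C₀ * S ^ 2)) ^ k := by
          gcongr
          norm_num
      _ = φ ^ 11 * (B * k * (C₀ * S ^ 2)) ^ k := by rw [hφdef]; ring
      _ ≤ (Real.exp 1 ^ k) ^ 11 * (B * k * (C₀ * S ^ 2)) ^ k := by gcongr
      _ = _ := by rw [mul_pow (Real.exp 1 ^ 11)]; congr 1; ring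
  rw [pow_mul, pow_le_pow_iff_left₀ (by positivity) (by positivity) (by omega)] at hpow
  refine le_of_sq_le_sq ?_ (by positivity)
  rw [mul_pow, mul_pow, Real.sq_sqrt (by positivity), Real.sq_sqrt (by linarith)]
  calc ‖F z‖ ^ 2 ≤ Real.exp 1 ^ 11 * (B * k * (C₀ * S ^ 2)) := hpow
    _ ≤ Real.exp 1 ^ 11 * (B * (2 * Real.log φ) * (C₀ * S ^ 2)) := by gcongr
    _ = _ := by ring

/-! ### Growth of log r and of h log(h μ_f). -/

section Growth

variable {a : ℕ → ℂ} {R : ℝ≥0∞} {h : ℝ → ℝ} {r₁ : ℝ}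

/-- A nonzero coefficient of positive index gives μ_f(r) ≥ |a_N| r for r ≥ 1; this is where
non-constancy enters. -/
lemma log_le_log_mul_maxTerm_add (ha : BoundedTerms a R) {N : ℕ} (hN : 1 ≤ N) (haN : a N ≠ 0)
    {r H : ℝ} (hr0 : 0 < r) (hrR : ENNReal.ofReal r < R) (hH : 1 ≤ H)
    (hμ : Real.exp 1 ≤ H * maxTerm a r) :
    Real.log r ≤ Real.log (H * maxTerm a r) + |Real.log ‖a N‖| := by
  have hpos : 0 < H * maxTerm a r := (Real.exp_pos 1).trans_le hμ
  have hV : 1 ≤ Real.log (H * maxTerm a r) := (Real.le_log_iff_exp_le hpos).2 hμ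
  rcases le_total r 1 with hr | hr
  · have := Real.log_nonpos hr0.le hr
    have := abs_nonneg (Real.log ‖a N‖)
    linarith
  · have haN' : 0 < ‖a N‖ := norm_pos_iff.2 haN
    have h1 : ‖a N‖ * r ≤ H * maxTerm a r :=
      calc ‖a N‖ * r = 1 * (‖a N‖ * r ^ 1) := by ring
        _ ≤ H * (‖a N‖ * r ^ N) := by gcongr
        _ ≤ _ := by gcongr; exact ha.term_le_maxTerm hr0.le hrR N
    have h2 := Real.log_le_log (by positivity) h1
    rw [Real.log_mul haN'.ne' hr0.ne'] at h2
    linarith [neg_abs_le (Real.log ‖a N‖)]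

/-- Makes the factor 1 + log² s in the polar weight cost no more than a multiple of V². -/
lemma exists_forall_abs_log_le (ha : BoundedTerms a R) {N : ℕ} (hN : 1 ≤ N) (haN : a N ≠ 0)
    (hr₁ : 0 < r₁) (h1 : ∀ r ∈ radii r₁ R, 1 ≤ h r)
    (hμ : ∀ r ∈ radii r₁ R, Real.exp 1 ≤ h r * maxTerm a r) :
    ∃ c : ℝ, 0 ≤ c ∧ ∀ r ∈ radii r₁ R, ∀ s, r ≤ s → s ≤ 2 * r → ENNReal.ofReal s < R →
      |Real.log s| ≤ c + Real.log (h r * maxTerm a r) := by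
  refine ⟨|Real.log r₁| + Real.log 2 + |Real.log ‖a N‖|, by
    have := Real.log_pos one_lt_two; positivity, fun r hr s hrs hs _ => ?_⟩
  have hr0 : 0 < r := hr₁.trans_le hr.1
  have hle := log_le_log_mul_maxTerm_add ha hN haN hr0 hr.2 (h1 r hr) (hμ r hr)
  have hV : 1 ≤ Real.log (h r * maxTerm a r) :=
    (Real.le_log_iff_exp_le ((Real.exp_pos 1).trans_le (hμ r hr))).2 (hμ r hr)
  have hlow : Real.log r₁ ≤ Real.log s := Real.log_le_log hr₁ (hr.1.trans hrs)
  have hup : Real.log s ≤ Real.log 2 + Real.log r := by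
    rw [← Real.log_mul two_ne_zero hr0.ne']
    exact Real.log_le_log (hr0.trans_le hrs) hs
  have := Real.log_pos one_lt_two
  have := abs_nonneg (Real.log ‖a N‖)
  have := abs_nonneg (Real.log r₁)
  rw [abs_le]
  constructor
  · linarith [neg_abs_le (Real.log r₁)]
  · linarith

/-- For R = ∞ the logarithm is unbounded because μ_f is. For R < ∞ a bounded product would bound h,
and then h(t)/t would be integrable on the bounded set [r₁, R). -/
lemma exists_forall_le_mul_log (ha : BoundedTerms a R) {N : ℕ} (hN : 1 ≤ N) (haN : a N ≠ 0)
    (hr₁ : 0 < r₁) (hr₁R : ENNReal.ofReal r₁ < R) (hmono : MonotoneOn h (radii r₁ R))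
    (h1 : ∀ r ∈ radii r₁ R, 1 ≤ h r) (hμ : ∀ r ∈ radii r₁ R, Real.exp 1 ≤ h r * maxTerm a r)
    (htop : ∫⁻ t in radii r₁ R, ENNReal.ofReal (h t / t) = ∞) (M : ℝ) :
    ∃ r₂ ∈ radii r₁ R, ∀ r ∈ radii r₂ R, M ≤ h r * Real.log (h r * maxTerm a r) := by
  have hV : ∀ r ∈ radii r₁ R, 1 ≤ Real.log (h r * maxTerm a r) := fun r hr =>
    (Real.le_log_iff_exp_le ((Real.exp_pos 1).trans_le (hμ r hr))).2 (hμ r hr)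
  rcases eq_or_ne R ∞ with rfl | hRtop
  · refine ⟨max r₁ (Real.exp (M + |Real.log ‖a N‖|)), ⟨le_max_left _ _, ENNReal.ofReal_lt_top⟩,
      fun r hr => ?_⟩
    have hr' : r ∈ radii r₁ ∞ := radii_anti (le_max_left _ _) hr
    have hr0 : 0 < r := hr₁.trans_le hr'.1
    have hle := log_le_log_mul_maxTerm_add ha hN haN hr0 hr'.2 (h1 r hr') (hμ r hr')
    have : M + |Real.log ‖a N‖| ≤ Real.log r :=
      (Real.le_log_iff_exp_le hr0).2 ((le_max_right _ _).trans hr.1)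
    have := hV r hr'
    have := h1 r hr'
    nlinarith
  · by_contra! hcon
    have hbd : ∀ t ∈ radii r₁ R, ENNReal.ofReal (h t / t) ≤ ENNReal.ofReal (M / r₁) :=
      fun t ht => by
        obtain ⟨r, hr, hrM⟩ := hcon t ht
        have hr' := radii_anti ht.1 hr
        have h2 := hmono ht hr' hr.1
        have h3 := hV r hr'
        have h4 := h1 r hr'
        have h5 := h1 t ht
        have hM : h t ≤ M := by nlinarith
        have hM0 : 0 ≤ M := by linarith
        have := ht.1
        exact ENNReal.ofReal_le_ofReal (by gcongr)
    have hvol : volume (radii r₁ R) ≤ ENNReal.ofReal (R.toReal - r₁) := by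
      rw [← Real.volume_Icc]
      exact measure_mono fun t ht =>
        ⟨ht.1, (ENNReal.ofReal_le_iff_le_toReal hRtop).1 ht.2.le⟩
    have := (setLIntegral_mono' (μ := volume) (measurableSet_radii r₁ R) hbd).trans_eq
      (setLIntegral_const _ _)
    rw [htop, top_le_iff] at this
    exact ENNReal.mul_ne_top ENNReal.ofReal_ne_top (hvol.trans_lt ENNReal.ofReal_lt_top).ne this

end Growth

/-! ### Radii close to R, almost sure moment bounds and the conclusion. -/

lemma exists_forall_of_eventually_tendingTo {R : ℝ≥0∞} (hR : 0 < R) {p : ℝ → Prop}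
    (hp : ∀ᶠ r in tendingTo R, p r) :
    ∃ r₁ : ℝ, 0 < r₁ ∧ ENNReal.ofReal r₁ < R ∧ ∀ r ∈ radii r₁ R, p r := by
  rw [tendingTo, eventually_comap] at hp
  obtain ⟨l, hl, hlp⟩ := (mem_nhdsLT_iff_exists_Ioo_subset' hR).1 hp
  obtain ⟨l', hl', hl'R⟩ := exists_between (show l < R from hl)
  have htop : l' ≠ ∞ := (hl'R.trans_le le_top).ne
  refine ⟨l'.toReal, ENNReal.toReal_pos (pos_of_gt hl').ne' htop, ?_, fun r hr => ?_⟩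
  · rwa [ENNReal.ofReal_toReal htop]
  · refine hlp (a := ENNReal.ofReal r) ⟨hl'.trans_le ?_, hr.2⟩ r rfl
    rw [← ENNReal.ofReal_toReal htop]
    exact ENNReal.ofReal_le_ofReal hr.1

lemma LimitGT.exists_forall_lt {R : ℝ≥0∞} (hR : 0 < R) {g : ℝ → ℝ} {c : ℝ} (hc : 0 ≤ c)
    (hg : LimitGT R g c) :
    ∃ r₁ : ℝ, 0 < r₁ ∧ ENNReal.ofReal r₁ < R ∧ ∀ r ∈ radii r₁ R, c < g r := by
  obtain ⟨L, hL, hcL⟩ := hg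
  refine exists_forall_of_eventually_tendingTo hR ?_
  filter_upwards [(tendsto_order.1 hL).1 _ hcL] with r hr
  exact (ENNReal.ofReal_lt_ofReal_iff_of_nonneg hc).1 hr

lemma ae_exists_polar_moments_le {Ω : Type*} [MeasurableSpace Ω] {P : Measure Ω}
    [IsProbabilityMeasure P] {a : ℕ → ℂ} {R : ℝ≥0∞} (ha : BoundedTerms a R)
    {X : ℕ → Ω → ℂ} (hX : ∀ n, Measurable (X n))
    (hind : iIndepFun X P) {lam K : ℝ} (hK : 0 < K) (hlam : 0 < lam)
    (hexp : ∀ n, ∫⁻ ω, ENNReal.ofReal (Real.exp (lam * ‖X n ω‖ ^ 2)) ∂P ≤ ENNReal.ofReal (1 + K))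
    (hX0 : ∀ n, ∫ ω, X n ω ∂P = 0) {r₁ : ℝ} (hr₁ : 0 < r₁)
    (hS : ∀ s ∈ radii r₁ R, 0 < ellTwoMean a s) :
    ∃ B : ℝ, 0 < B ∧ ∀ᵐ ω ∂P, ∃ J : ℝ, 0 ≤ J ∧ ∀ k : ℕ, 1 ≤ k →
      ∫⁻ s in radii r₁ R, ENNReal.ofReal (logSqWeight s) *
        ∫⁻ θ in Ioc 0 (2 * Real.pi), ENNReal.ofReal (1 / (B * k * ellTwoMean a s ^ 2) ^ k) *
          ‖randomSeries a X ω (circleMap 0 s θ)‖ₑ ^ (2 * k) ≤ ENNReal.ofReal J := by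
  set b : ℝ := 8 * Real.exp 1 * ((1 / 4 + K) / lam) with hb
  have hb0 : 0 < b := by positivity
  -- Doubling the moment constant b makes the normalised moment of order 2k at most 4 · 2^{-k},
  -- hence summable.
  refine ⟨2 * b, by positivity, ?_⟩
  have := isFiniteMeasure_polarMeasure hr₁ R
  have hcirc : Measurable fun t : ℝ × ℝ => circleMap 0 t.1 t.2 := by
    unfold circleMap; fun_prop
  have hSm := measurable_ellTwoMean a
  have hmeas : ∀ k : ℕ, Measurable (Function.uncurry fun (ω : Ω) (t : ℝ × ℝ) =>
      ENNReal.ofReal (1 / (2 * b * (k + 1 : ℕ) * ellTwoMean a t.1 ^ 2) ^ (k + 1)) *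
        ‖randomSeries a X ω (circleMap 0 t.1 t.2)‖ₑ ^ (2 * (k + 1))) := fun k => by
    have h1 : Measurable fun p : Ω × (ℝ × ℝ) => ellTwoMean a p.2.1 :=
      hSm.comp (measurable_fst.comp measurable_snd)
    have h2 : Measurable fun p : Ω × (ℝ × ℝ) => randomSeries a X p.1 (circleMap 0 p.2.1 p.2.2) :=
      (measurable_randomSeries hX).comp (measurable_fst.prodMk (hcirc.comp measurable_snd))
    exact (((h1.pow_const 2).const_mul _).pow_const _).const_div 1 |>.ennreal_ofReal.mul
      (h2.enorm.pow_const _)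
  have hsum : ∑' k : ℕ, ENNReal.ofReal (4 * (1 / 2) ^ (k + 1)) ≠ ∞ :=
    (((summable_nat_add_iff 1).2 summable_geometric_two).mul_left 4).tsum_ofReal_ne_top
  have hbound : ∀ k : ℕ, ∀ᵐ t ∂(polarMeasure r₁ R), ∫⁻ ω,
      ENNReal.ofReal (1 / (2 * b * (k + 1 : ℕ) * ellTwoMean a t.1 ^ 2) ^ (k + 1)) *
        ‖randomSeries a X ω (circleMap 0 t.1 t.2)‖ₑ ^ (2 * (k + 1)) ∂P ≤
      ENNReal.ofReal (4 * (1 / 2) ^ (k + 1)) := fun k => by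
    refine ae_polarMeasure_of_forall fun s hs θ => ?_
    have hs0 : 0 < s := hr₁.trans_le hs.1
    have hSs := hS s hs
    have hnorm : ‖circleMap 0 s θ‖ = s := by rw [norm_circleMap_zero, abs_of_pos hs0]
    have hmom := lintegral_enorm_randomSeries_pow_le ha hX hind hK hlam hexp hX0
      (openDisc_of_norm_le hnorm.le hs.2) (by rwa [hnorm]) (Nat.le_add_left 1 k)
    rw [hnorm] at hmom
    simp only
    rw [lintegral_const_mul' _ _ ENNReal.ofReal_ne_top]
    refine (mul_le_mul_right hmom _).trans_eq ?_
    rw [← ENNReal.ofReal_mul (by positivity), ← hb]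
    congr 1
    have hk0 : (0 : ℝ) < (k + 1 : ℕ) := by positivity
    rw [show 2 * b * (k + 1 : ℕ) * ellTwoMean a s ^ 2 =
      2 * (b * ellTwoMean a s ^ 2 * (k + 1 : ℕ)) by ring, mul_pow 2, one_div_pow]
    have : 0 < (b * ellTwoMean a s ^ 2 * (k + 1 : ℕ)) ^ (k + 1) := by positivity
    field_simp
  filter_upwards [ae_exists_lintegral_le hmeas hsum hbound] with ω hω
  obtain ⟨J, hJ0, hJ⟩ := hω
  refine ⟨J, hJ0, fun k hk => ?_⟩
  obtain ⟨j, rfl⟩ := Nat.exists_eq_add_of_le' hk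
  have hm := (hmeas j).comp (measurable_prodMk_left (x := ω))
  exact (lintegral_polarMeasure hm).symm.trans_le (hJ j)

theorem theorem5p2 {Ω : Type*} [MeasurableSpace Ω] (P : Measure Ω) [IsProbabilityMeasure P]
    (R : ℝ≥0∞) (hR : 0 < R)
    (f : ℂ → ℂ) (a : ℕ → ℂ)
    (hf : ∀ z ∈ openDisc R, HasSum (fun n => a n * z ^ n) (f z))
    (hf_nonconst : ¬ ∃ c : ℂ, ∀ z ∈ openDisc R, f z = c)
    (ρ : ℝ) (hρ : 0 ≤ ρ) (hρR : ENNReal.ofReal ρ < R)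
    (h : ℝ → ℝ) (hh : IsLogWeight h ρ R)
    (hh_lim : LimitGT R h 1)
    (hh_mu_lim : LimitGT R (fun r => h r * maxTerm a r) (Real.exp 1))
    (X : ℕ → Ω → ℂ) (hX_meas : ∀ n, Measurable (X n))
    (hX_indep : iIndepFun X P)
    (hX_centred : ∀ n, ∫ ω, X n ω ∂P = 0)
    (hX_subgaussian : IsSubgaussianSeq P X) :
    (∀ᵐ ω ∂P, (∀ z ∈ openDisc R, Summable (fun n => a n * X n ω * z ^ n)) ∧
      AnalyticOnNhd ℂ (randomSeries a X ω) (openDisc R)) ∧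
    ∃ E : Set ℝ, IsOpen E ∧ E ⊆ radii 0 R ∧ logMeasure h ρ R E < ∞ ∧
      ∃ C : ℝ, 0 < C ∧
        ∀ᵐ ω ∂P, ∃ r₀ : ℝ, ρ < r₀ ∧ ENNReal.ofReal r₀ < R ∧
          ∀ r ∈ radii r₀ R, r ∉ E → ∀ z : ℂ, ‖z‖ = r →
            ‖randomSeries a X ω z‖ ≤
              C * Real.sqrt (Real.log (h r * Real.log (h r * maxTerm a r))) * ellTwoMean a r := by
  have ha : BoundedTerms a R := boundedTerms_of_hasSum hf
  obtain ⟨N, hN, haN⟩ := exists_coeff_ne_zero hf hf_nonconst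
  obtain ⟨K, τ, hK, hτ, htail⟩ := hX_subgaussian
  set lam : ℝ := 1 / (2 * τ ^ 2) with hlam_def
  have hlam : 0 < lam := by positivity
  have hexp : ∀ n, ∫⁻ ω, ENNReal.ofReal (Real.exp (lam * ‖X n ω‖ ^ 2)) ∂P ≤
      ENNReal.ofReal (1 + K) := fun n => by
    have := lintegral_exp_sq_le_of_tail (hX_meas n) hK hτ (htail n)
    simpa only [hlam_def, one_div_mul_eq_div] using this
  have hgrowth := ae_exists_norm_le_mul_sq hX_meas hlam hexp
  refine ⟨?_, ?_⟩
  · filter_upwards [hgrowth] with ω ⟨C, _, hC⟩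
    exact ⟨fun z hz => summable_of_growth ha hC hz,
      (differentiableOn_randomSeries ha hC).analyticOnNhd (isOpen_openDisc R)⟩
  obtain ⟨p, hp0, hpR, hp⟩ := hh_lim.exists_forall_lt hR zero_le_one
  obtain ⟨q, hq0, hqR, hq⟩ := hh_mu_lim.exists_forall_lt hR (Real.exp_pos 1).le
  obtain ⟨u, hu, hu0, huR⟩ := exists_radius_between hρR
  obtain ⟨r₁, hr₁ρ, hr₁p, hr₁q, hr₁R⟩ : ∃ r₁ : ℝ, ρ < r₁ ∧ p ≤ r₁ ∧ q ≤ r₁ ∧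
      ENNReal.ofReal r₁ < R := by
    refine ⟨max u (max p q), hu.trans_le (le_max_left _ _),
      (le_max_left _ _).trans (le_max_right _ _), (le_max_right _ _).trans (le_max_right _ _), ?_⟩
    rcases max_choice u (max p q) with h | h <;> rw [h]
    · exact huR
    · rcases max_choice p q with h | h <;> rw [h]
      exacts [hpR, hqR]
  have hr₁ : 0 < r₁ := hρ.trans_lt hr₁ρ
  have hsubρ : radii r₁ R ⊆ radii ρ R := radii_anti hr₁ρ.le
  have hsub0 : radii r₁ R ⊆ radii 0 R := radii_anti hr₁.le
  have hh1 : ∀ r ∈ radii r₁ R, 1 ≤ h r := fun r hr => (hp r (radii_anti hr₁p hr)).le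
  have hμ : ∀ r ∈ radii r₁ R, Real.exp 1 ≤ h r * maxTerm a r := fun r hr =>
    (hq r (radii_anti hr₁q hr)).le
  have hmono := hh.monotoneOn.mono hsubρ
  -- If ρ = 0, the divergence may come from the singularity of 1/t at 0 alone. Then all of (r₁, R)
  -- has finite measure and can be taken as the exceptional set, so nothing remains to be bounded.
  by_cases htop : ∫⁻ t in radii r₁ R, ENNReal.ofReal (h t / t) = ∞
  swap
  · obtain ⟨r₀, hr₁r₀, -, hr₀R⟩ := exists_radius_between hr₁R
    refine ⟨_, isOpen_Ioi_inter_radii r₁ R, fun r hr => hsub0 ⟨hr.1.le, hr.2⟩, ?_, 1, one_pos,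
      Eventually.of_forall fun ω => ⟨r₀, hr₁ρ.trans hr₁r₀, hr₀R, fun r hr hrE => ?_⟩⟩
    · refine lt_of_le_of_lt (lintegral_mono_set fun r hr => ?_) (lt_top_iff_ne_top.2 htop)
      exact ⟨hr.1.1.le, hr.1.2⟩
    · exact absurd ⟨hr₁r₀.trans_le hr.1, hr.2⟩ hrE
  obtain ⟨E, hEo, hEr, hEm, hE⟩ := exists_isOpen_forall_notMem_geometric_decay ha hr₁ hr₁R
    (hh.continuousOn.mono hsubρ) hmono hh1 hμ htop
  have hS : ∀ s ∈ radii r₁ R, 0 < ellTwoMean a s := fun s hs =>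
    ha.ellTwoMean_pos haN (hr₁.trans_le hs.1) hs.2
  obtain ⟨B, hB, hmom⟩ := ae_exists_polar_moments_le ha hX_meas hX_indep hK hlam hexp hX_centred
    hr₁ hS
  obtain ⟨c, hc, hlog⟩ := exists_forall_abs_log_le ha hN haN hr₁ hh1 hμ
  refine ⟨E, hEo, hEr.trans hsub0, (lintegral_mono_set inter_subset_left).trans_lt hEm,
    Real.sqrt (2 * Real.exp 1 ^ 11 * B * (1 + 2 * Real.exp 1 ^ 2)), by positivity, ?_⟩
  filter_upwards [hgrowth, hmom] with ω ⟨C, _, hC⟩ ⟨J, hJ0, hJ⟩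
  -- Only here does ω matter for the radii: r₂ depends on J, whereas `E`, `B` and the final constant
  -- are already fixed.
  obtain ⟨r₂, hr₂, hφ⟩ := exists_forall_le_mul_log ha hN haN hr₁ hr₁R hmono hh1 hμ htop
    (max (Real.exp 1) (128 * (1 + (c + 1) ^ 2) * Real.exp 1 ^ 4 * J))
  obtain ⟨r₀, hr₂r₀, -, hr₀R⟩ := exists_radius_between hr₂.2
  have hr₁r₀ : r₁ < r₀ := hr₂.1.trans_lt hr₂r₀
  refine ⟨r₀, hr₁ρ.trans hr₁r₀, hr₀R, ?_⟩
  rintro r hr hrE z rfl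
  have hr' : ‖z‖ ∈ radii r₁ R := radii_anti hr₁r₀.le hr
  obtain ⟨hδR, hdecay⟩ := hE _ hr' (hr₁r₀.trans_le hr.1) hrE _ rfl
  have hφr := hφ ‖z‖ (radii_anti hr₂r₀.le hr)
  refine norm_le_of_polar_moments ha (differentiableOn_randomSeries ha hC) hr₁ hr'.1 hS
    (hh1 _ hr') ((Real.le_log_iff_exp_le ((Real.exp_pos 1).trans_le (hμ _ hr'))).2 (hμ _ hr'))
    rfl hδR (fun n => (hdecay n).trans ?_) hc (hlog _ hr') hB hJ0 hJ
    ((le_max_left _ _).trans hφr) ((le_max_right _ _).trans hφr)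
  gcongr
  exact ha.maxTerm_le_ellTwoMean (norm_nonneg z) hr'.2
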